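/- Call a group indecomposable if it is nontrivial, is not isomorphic to $\mathbb Z$, and is not a free product of two nontrivial groups. A standard decomposition of a finitely generated group $G$ is a decomposition as an internal free product of subgroups $$G=G_1*\cdots*G_m*G_{m+1}*\cdots*G_{m+n}\qquad(m,n\ge 0)$$ in which $G_i$ is indecomposable for $i\le m$ and $G_i\cong\mathbb Z$ for $i>m$. The subgroups $G_1,\dots,G_m$ occurring in standard decompositions of $G$ are called the indecomposable factors of $G$. The pair $c(G)=(m+n,n)$, which depends only on $G$, is the Scott complexity of $G$; such pairs are ordered lexicographically. Theorem 1.2. Let $\phi:G\to H$ be a surjective homomorphism of finitely generated groups such that for each indecomposable factor $K$ of $G$ the subgroup $\phi(K)$ is conjugate in $H$ to a subgroup of an indecomposable factor of $H$. Then $c(G)\ge c(H)$. Moreover, if $c(G)=c(H)=(m+n,n)$ and $$H=H_1*\cdots*H_m*H_{m+1}*\cdots*H_{m+n}$$ is any standard decomposition of $H$, then there is a standard decomposition $$G=G_1*\cdots*G_m*G_{m+1}*\cdots*G_{m+n}$$ such that $\phi(G_i)=H_i$ for all $1\le i\le m+n$. -/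

import Mathlib

/-- The group `G` is the (internal) free product of the family of subgroups `A`: the canonical
homomorphism from the free product of the groups `A i` to `G` is bijective. -/
def IsInternalFreeProduct {G : Type*} [Group G] {ι : Type*} (A : ι → Subgroup G) : Prop :=
  Function.Bijective (Monoid.CoprodI.lift fun i => (A i).subtype)

/-- A group is indecomposable if it is nontrivial, is not infinite cyclic, and is not the free
product of two nontrivial subgroups. -/
structure IsIndecomposableGroup (G : Type*) [Group G] : Prop where
  nontrivial : Nontrivial G
  not_infinite_cyclic : ¬ Nonempty (G ≃* Multiplicative ℤ)
  not_free_product : ∀ A : Fin 2 → Subgroup G, IsInternalFreeProduct A → ∃ i, A i = ⊥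

/-- A standard decomposition `G = G₁ * ⋯ * G_m * G_{m+1} * ⋯ * G_{m+n}`: the first `m` factors
(index `Sum.inl i`) are indecomposable, the last `n` (index `Sum.inr j`) are infinite cyclic. -/
structure IsStandardDecomposition {G : Type*} [Group G] {m n : ℕ}
    (A : Fin m ⊕ Fin n → Subgroup G) : Prop where
  free_product : IsInternalFreeProduct A
  indecomposable : ∀ i : Fin m, IsIndecomposableGroup (A (Sum.inl i))
  infinite_cyclic : ∀ j : Fin n, Nonempty (A (Sum.inr j) ≃* Multiplicative ℤ)

/-- `K` is an indecomposable factor of `G`: one of the indecomposable (not infinite cyclic)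
factors of a standard decomposition of `G`. -/
def IsIndecomposableFactor {G : Type*} [Group G] (K : Subgroup G) : Prop :=
  ∃ (m n : ℕ) (A : Fin m ⊕ Fin n → Subgroup G) (i : Fin m),
    IsStandardDecomposition A ∧ A (Sum.inl i) = K

/-- The pair `c` is `(m + n, n)` for some standard decomposition of `G` with `m` indecomposable
and `n` infinite cyclic factors. Pairs carry the lexicographic order. -/
def HasScottComplexity (G : Type*) [Group G] (c : ℕ ×ₗ ℕ) : Prop :=
  ∃ (m n : ℕ) (A : Fin m ⊕ Fin n → Subgroup G),
    IsStandardDecomposition A ∧ c = toLex (m + n, n)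

open Classical in
/-- The Scott complexity `c(G) = (m + n, n)` of `G`, in `ℕ × ℕ` with the lexicographic order.
A finitely generated group has a standard decomposition, and `(m + n, n)` does not depend on it;
the value `(0, 0)` for groups without a standard decomposition is a convention. -/
noncomputable def scottComplexity (G : Type*) [Group G] : ℕ ×ₗ ℕ :=
  if h : ∃ c, HasScottComplexity G c then h.choose else toLex (0, 0)

-- The core is Higgins' form of Grushko's theorem (`IsInternalFreeProduct.exists_lift`): the
-- decomposition `H = ∗ B i` lifts along `φ` to `G = ∗ A i` with `φ(A i) = B i`, because each factor
-- of a standard decomposition of `G` is cyclic or goes into a conjugate of some `B i`. All `A i`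
-- are nontrivial, so `G` has at least as many factors as `H`. If the numbers agree, no `A i` can be
-- split further, so each is indecomposable or infinite cyclic. An indecomposable `A i` lying over a
-- cyclic `B i` would be an indecomposable factor of `G`, so `B i` would be conjugate into an
-- indecomposable factor of `H`, which is impossible. Hence `H` has at most as many cyclic factors
-- as `G`, and if these numbers also agree, `A` is itself standard.
--
-- Bass–Serre trees are replaced by families of equivalence relations on a free `G`-set `G × J`.
-- Points and classes form a bipartite graph; acyclicity is expressed by `HasPotentials`: every
-- cocycle is a coboundary. With one orbit, the stabilizers of the classes through a point decompose
-- `G` as a free product. With several orbits, an edge between two orbits may be contracted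
-- equivariantly (`IsTreeSystem.merge`).
--
-- For the lifting theorem, a tree system for `G` is mapped equivariantly to `H` with its family of
-- cosets. As long as there are two orbits, reduced words in `∗ B i` give an edge between different
-- orbits with equal labels (`exists_tie`); contracting such edges ends with one orbit.
--
-- Tree systems also replace Kurosh's theorem: a finitely generated indecomposable subgroup of `∗ B
-- i` is conjugate into some `B i` (`IsInternalFreeProduct.exists_conj_mem`). This makes the
-- complexity well defined and moves the hypothesis on factors to any chosen decomposition of `H`.
-- Existence of standard decompositions follows from the bound on the number of factors that the
-- lifting theorem gives for free groups.

universe u v w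

open Relation

/-! ### Free products: universal property, retractions, regrouping -/

namespace IsInternalFreeProduct

variable {G : Type*} [Group G] {ι : Type*} {A : ι → Subgroup G}

theorem iSup_eq_top (hA : IsInternalFreeProduct A) : ⨆ i, A i = ⊤ := by
  have h := Monoid.CoprodI.range_eq_iSup (fun i => ↥(A i)) fun i => (A i).subtype
  rw [MonoidHom.range_eq_top.2 hA.surjective] at h
  simpa using h.symm

theorem exists_hom (hA : IsInternalFreeProduct A) {K : Type*} [Group K] (f : ∀ i, A i →* K) :
    ∃ F : G →* K, ∀ i (a : A i), F a = f i a := by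
  let e := MulEquiv.ofBijective (Monoid.CoprodI.lift fun i => (A i).subtype) hA
  refine ⟨(Monoid.CoprodI.lift f).comp e.symm.toMonoidHom, fun i a => ?_⟩
  have : e.symm (a : G) = Monoid.CoprodI.of (M := fun i => ↥(A i)) a := by
    rw [MulEquiv.symm_apply_eq]
    exact (Monoid.CoprodI.lift_of (fun i => (A i).subtype) a).symm
  simp [this]

end IsInternalFreeProduct

theorem iSup_fin_two_eq {α : Type*} [CompleteLattice α] (f : Fin 2 → α) :
    ⨆ i, f i = f 0 ⊔ f 1 :=
  le_antisymm (iSup_le fun i => by fin_cases i <;> simp)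
    (sup_le (le_iSup f 0) (le_iSup f 1))

theorem MonoidHom.eq_of_iSup_eq_top {G K : Type*} [Group G] [Group K] {ι : Type*}
    {A : ι → Subgroup G} (hA : ⨆ i, A i = ⊤) {F F' : G →* K}
    (h : ∀ i, ∀ a ∈ A i, F a = F' a) : F = F' := by
  have : ⨆ i, A i ≤ F.eqLocus F' := iSup_le fun i a ha => h i a ha
  ext g
  exact this (hA ▸ Subgroup.mem_top g)

/-- Test groups in the universe of `G` suffice, since the external free product lies there and
supplies a left inverse. Later decompositions are proved by extending homomorphisms, so normal forms
are needed only once, in `exists_tie`. -/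
theorem isInternalFreeProduct_of_exists_hom {G : Type u} [Group G] {ι : Type}
    {A : ι → Subgroup G} (hsup : ⨆ i, A i = ⊤)
    (hext : ∀ (K : Type u) [Group K] (f : ∀ i, A i →* K),
      ∃ F : G →* K, ∀ i (a : A i), F a = f i a) :
    IsInternalFreeProduct A := by
  constructor
  · obtain ⟨F, hF⟩ := hext (Monoid.CoprodI fun i => A i) (fun i =>
      Monoid.CoprodI.of (M := fun i => ↥(A i)))
    have : F.comp (Monoid.CoprodI.lift fun i => (A i).subtype) = MonoidHom.id _ := by
      ext i a
      simp [hF]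
    exact Function.LeftInverse.injective (g := F) fun x => DFunLike.congr_fun this x
  · rw [← MonoidHom.range_eq_top, Monoid.CoprodI.range_eq_iSup]
    simpa using hsup

namespace IsInternalFreeProduct

section Retraction

variable {G : Type*} [Group G] {ι : Type*} {A : ι → Subgroup G}

theorem exists_retraction (hA : IsInternalFreeProduct A) (i : ι) :
    ∃ r : G →* A i, (∀ a : A i, r a = a) ∧ ∀ j ≠ i, ∀ a ∈ A j, r a = 1 := by
  classical
  obtain ⟨r, hr⟩ := hA.exists_hom (K := A i)
    (fun j => if h : j = i then (MulEquiv.subgroupCongr (congrArg A h)).toMonoidHom else 1)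
  refine ⟨r, fun a => ?_, fun j hj a ha => ?_⟩
  · rw [hr i a]
    simp
    rfl
  · rw [hr j ⟨a, ha⟩]
    simp [hj]

/-- The retraction onto `A i` kills every conjugate of `A j` and is the identity on `A i`. -/
theorem eq_bot_of_conj (hA : IsInternalFreeProduct A) {i j : ι} (hij : i ≠ j) {g : G}
    (h : ∀ a ∈ A i, g⁻¹ * a * g ∈ A j) : A i = ⊥ := by
  obtain ⟨r, hr, hr'⟩ := hA.exists_retraction i
  rw [Subgroup.eq_bot_iff_forall]
  intro a ha
  have h1 := hr' j hij.symm _ (h a ha)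
  have h2 : r a = ⟨a, ha⟩ := hr ⟨a, ha⟩
  rw [map_mul, map_mul, map_inv, h2] at h1
  have h3 : (⟨a, ha⟩ : A i) = 1 := by
    have := congrArg (fun x => r g * x * (r g)⁻¹) h1
    simpa [mul_assoc] using this
  simpa using congrArg Subtype.val h3

theorem fg (hA : IsInternalFreeProduct A) [Group.FG G] (i : ι) : Group.FG (A i) := by
  obtain ⟨r, hr, -⟩ := hA.exists_retraction i
  exact Group.fg_of_surjective (f := r) fun a => ⟨a, hr a⟩

end Retraction

section Regroup

variable {G : Type u} [Group G] {ι : Type} {A : ι → Subgroup G}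

theorem reindex (hA : IsInternalFreeProduct A) {κ : Type} (e : κ ≃ ι) :
    IsInternalFreeProduct fun k => A (e k) := by
  refine isInternalFreeProduct_of_exists_hom ?_ fun K _ f => ?_
  · rw [← hA.iSup_eq_top, e.iSup_comp (g := A)]
  · obtain ⟨F, hF⟩ := hA.exists_hom (K := K)
      (fun i => (f (e.symm i)).comp
        (MulEquiv.subgroupCongr (congrArg A (e.apply_symm_apply i).symm)).toMonoidHom)
    refine ⟨F, fun k a => ?_⟩
    rw [hF (e k) a]
    have : ∀ k' (h : k' = k) (h' : A (e k) = A (e k')),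
        f k' (MulEquiv.subgroupCongr h' a) = f k a := by
      rintro k' rfl h'
      rfl
    exact this _ (e.symm_apply_apply k) _

theorem sigma (hA : IsInternalFreeProduct A) {κ : ι → Type}
    {C : ∀ i, κ i → Subgroup (A i)} (hC : ∀ i, IsInternalFreeProduct (C i)) :
    IsInternalFreeProduct fun p : Σ i, κ i => (C p.1 p.2).map (A p.1).subtype := by
  refine isInternalFreeProduct_of_exists_hom ?_ fun K _ f => ?_
  · rw [iSup_sigma, ← hA.iSup_eq_top]
    refine iSup_congr fun i => ?_
    change ⨆ k, (C i k).map (A i).subtype = A i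
    rw [← Subgroup.map_iSup, (hC i).iSup_eq_top, ← MonoidHom.range_eq_map, Subgroup.range_subtype]
  · have h1 : ∀ i, ∃ F : A i →* K, ∀ k (c : C i k), F c = f ⟨i, k⟩
        ⟨((c : A i) : G), Subgroup.mem_map_of_mem (A i).subtype c.2⟩ := fun i => by
      obtain ⟨F, hF⟩ := (hC i).exists_hom (K := K) (fun k => (f ⟨i, k⟩).comp
        ((C i k).equivMapOfInjective (A i).subtype (A i).subtype_injective).toMonoidHom)
      exact ⟨F, fun k c => hF k c⟩
    choose F hF using h1
    obtain ⟨F', hF'⟩ := hA.exists_hom F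
    refine ⟨F', ?_⟩
    rintro ⟨i, k⟩ ⟨_, c, hc, rfl⟩
    have := hF' i c
    rw [hF i k ⟨c, hc⟩] at this
    exact this

theorem fin_two (hA : IsInternalFreeProduct A) (i : ι) :
    IsInternalFreeProduct (![A i, ⨆ j : {j // j ≠ i}, A j] : Fin 2 → Subgroup G) := by
  classical
  refine isInternalFreeProduct_of_exists_hom ?_ fun K _ f => ?_
  · rw [eq_top_iff, ← hA.iSup_eq_top, iSup_le_iff]
    intro j
    by_cases h : j = i
    · subst h
      exact le_iSup_of_le 0 le_rfl
    · exact le_iSup_of_le 1 (le_iSup (fun j : {j // j ≠ i} => A j) ⟨j, h⟩)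
  · have hle : ∀ j, j ≠ i → A j ≤ ⨆ j : {j // j ≠ i}, A j := fun j h =>
      le_iSup (fun j : {j // j ≠ i} => A j) ⟨j, h⟩
    obtain ⟨F, hF⟩ := hA.exists_hom (K := K) (fun j => if h : j = i then
      (f 0).comp (MulEquiv.subgroupCongr (congrArg A h)).toMonoidHom else
      (f 1).comp (Subgroup.inclusion (hle j h)))
    have hF0 : ∀ a : A i, F a = f 0 a := fun a => by
      rw [hF i a]
      simp
      rfl
    have hF1 : ∀ a : (⨆ j : {j // j ≠ i}, A j : Subgroup G), F a = f 1 a := by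
      rintro ⟨a, ha⟩
      induction ha using Subgroup.iSup_induction' with
      | hp j a ha =>
        rw [hF j ⟨a, ha⟩]
        simp [j.2]
        rfl
      | h1 =>
        exact (map_one F).trans (map_one (f 1)).symm
      | hmul x y hx hy h h' =>
        exact (map_mul F x y).trans ((congrArg₂ _ h h').trans (map_mul (f 1) ⟨x, hx⟩ ⟨y, hy⟩).symm)
    refine ⟨F, fun k => ?_⟩
    fin_cases k
    · exact hF0
    · exact hF1

end Regroup

end IsInternalFreeProduct

/-! ### Indecomposable groups -/

namespace IsIndecomposableGroup

/-- A nontrivial factor is played against the join of all the others, which reduces to two factors.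
-/
theorem exists_eq_top {G : Type u} [Group G] (hG : IsIndecomposableGroup G) {ι : Type}
    {A : ι → Subgroup G} (hA : IsInternalFreeProduct A) : ∃ i, A i = ⊤ := by
  have := hG.nontrivial
  have h : ∃ i, A i ≠ ⊥ := by
    by_contra! h
    have := hA.iSup_eq_top
    simp [h] at this
  obtain ⟨i, hi⟩ := h
  have h2 := hA.fin_two i
  obtain ⟨k, hk⟩ := hG.not_free_product _ h2
  have hs := h2.iSup_eq_top
  rw [iSup_fin_two_eq] at hs
  fin_cases k
  · exact absurd hk hi
  · refine ⟨i, ?_⟩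
    have hk' : (⨆ j : {j // j ≠ i}, A j) = ⊥ := hk
    simpa [hk'] using hs

theorem of_mulEquiv {G : Type u} {G' : Type u} [Group G] [Group G'] (e : G ≃* G')
    (hG : IsIndecomposableGroup G) : IsIndecomposableGroup G' := by
  have := hG.nontrivial
  refine ⟨e.symm.toEquiv.nontrivial, fun ⟨e'⟩ =>
    hG.not_infinite_cyclic ⟨e.trans e'⟩, fun A hA => ?_⟩
  have h : IsInternalFreeProduct fun i => (A i).comap e.toMonoidHom := by
    refine isInternalFreeProduct_of_exists_hom ?_ fun K _ f => ?_
    · have h := congrArg (Subgroup.map e.symm.toMonoidHom) hA.iSup_eq_top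
      rw [Subgroup.map_iSup, Subgroup.map_top_of_surjective _ e.symm.surjective] at h
      rw [← h]
      refine iSup_congr fun i => ?_
      exact (Subgroup.map_equiv_eq_comap_symm e.symm (A i)).symm
    · obtain ⟨F, hF⟩ := hA.exists_hom (K := K) (fun i =>
        (f i).comp ((e.symm.toMonoidHom.comp (A i).subtype).codRestrict
          ((A i).comap e.toMonoidHom) (fun x => by simp)))
      refine ⟨F.comp e.toMonoidHom, fun i a => ?_⟩
      refine (hF i ⟨e a, a.2⟩).trans ?_
      simp only [MonoidHom.comp_apply]
      congr 1
      exact Subtype.ext (e.symm_apply_apply (a : G))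
  obtain ⟨i, hi⟩ := hG.not_free_product _ h
  refine ⟨i, ?_⟩
  rw [Subgroup.eq_bot_iff_forall] at hi ⊢
  intro x hx
  simpa using hi (e.symm x) (by simpa using hx)

end IsIndecomposableGroup

/-! ### Cocycles and simple connectivity -/

section SimplyConnected

variable {X : Type*} {ι : Type*}

/-- A family `c` of `K`-valued functions is a cocycle for the equivalence relations `R` if it is
multiplicative along each of them. -/
def IsCocycle {K : Type*} [Group K] (R : ι → Setoid X) (c : ι → X → X → K) : Prop :=
  ∀ i a b d, R i a b → R i b d → c i a b * c i b d = c i a d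

/-- A family of equivalence relations on `X` is simply connected, in the sense that each cocycle
is the coboundary of a potential. -/
def HasPotentials (R : ι → Setoid X) : Prop :=
  ∀ (K : Type w) [Group K] (c : ι → X → X → K), IsCocycle R c →
    ∃ p : X → K, ∀ i a b, R i a b → p a * c i a b = p b

namespace IsCocycle

variable {K : Type*} [Group K] {R : ι → Setoid X} {c : ι → X → X → K}

theorem self (hc : IsCocycle R c) (i : ι) (a : X) : c i a a = 1 := by
  simpa using hc i a a a (Setoid.refl' _ a) (Setoid.refl' _ a)

theorem symm (hc : IsCocycle R c) {i : ι} {a b : X} (h : R i a b) : c i b a = (c i a b)⁻¹ := by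
  rw [eq_inv_iff_mul_eq_one, hc i b a b (Setoid.symm' _ h) h, hc.self]

theorem potential_of_eqvGen (hc : IsCocycle R c) {i : ι} {r : X → X → Prop} {p : X → K}
    (hr : ∀ a b, r a b → R i a b) (hp : ∀ a b, r a b → p a * c i a b = p b) {a b : X}
    (h : EqvGen r a b) : p a * c i a b = p b := by
  have hle : ∀ {a b}, EqvGen r a b → R i a b := fun h =>
    (Setoid.eqvGen_le (s := R i) hr) h
  induction h with
  | rel a b h => exact hp a b h
  | refl a => simp [hc.self]
  | symm a b h ih => rw [hc.symm (hle h), ← ih]; simp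
  | trans a b d h h' ih ih' => rw [← hc i a b d (hle h) (hle h'), ← mul_assoc, ih, ih']

end IsCocycle

/-- Deleting points from a forest leaves a forest. A cocycle on `Y` is extended to `X` and the
potential restricted back. -/
theorem HasPotentials.comap {R : ι → Setoid X} (hR : HasPotentials.{w} R) {Y : Type*}
    {f : Y → X} (hf : Function.Injective f) :
    HasPotentials.{w} fun i => (R i).comap f := by
  classical
  intro K _ c hc
  rcases isEmpty_or_nonempty Y with hY | hY
  · exact ⟨fun _ => 1, fun i a => hY.elim a⟩
  -- `r i` retracts each class that meets `Y` onto its part in `Y`; the cocycle is pulled back along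
  -- it, and set to `1` on classes missing `Y`.
  let r : ι → X → Y := fun i x =>
    if h : ∃ y, f y = x then h.choose else Classical.epsilon fun y => R i x (f y)
  have hrf : ∀ i y, r i (f y) = y := fun i y => by
    have h : ∃ y', f y' = f y := ⟨y, rfl⟩
    simp only [r, dif_pos h]
    exact hf h.choose_spec
  have hr : ∀ i x, (∃ y, R i x (f y)) → R i x (f (r i x)) := fun i x hx => by
    by_cases h : ∃ y, f y = x
    · simp only [r, dif_pos h, h.choose_spec]
      exact Setoid.refl' _ _
    · simp only [r, dif_neg h]
      exact Classical.epsilon_spec hx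
  obtain ⟨p, hp⟩ := hR K
    (fun i a b => if ∃ y, R i a (f y) then c i (r i a) (r i b) else 1) (by
      intro i a b d hab hbd
      have hiff : (∃ y, R i b (f y)) ↔ ∃ y, R i a (f y) :=
        ⟨fun ⟨y, hy⟩ => ⟨y, Setoid.trans' _ hab hy⟩,
          fun ⟨y, hy⟩ => ⟨y, Setoid.trans' _ (Setoid.symm' _ hab) hy⟩⟩
      simp only [hiff]
      split_ifs with h
      · have ha := hr i a h
        have hb := hr i b (hiff.2 h)
        have hd : R i d (f (r i d)) := by
          obtain ⟨y, hy⟩ := hiff.2 h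
          exact hr i d ⟨y, Setoid.trans' _ (Setoid.symm' _ hbd) hy⟩
        have h1 : R i (f (r i a)) (f (r i b)) :=
          Setoid.trans' _ (Setoid.symm' _ ha) (Setoid.trans' _ hab hb)
        have h2 : R i (f (r i b)) (f (r i d)) :=
          Setoid.trans' _ (Setoid.symm' _ hb) (Setoid.trans' _ hbd hd)
        exact hc i _ _ _ h1 h2
      · simp)
  refine ⟨p ∘ f, fun i a b hab => ?_⟩
  have := hp i (f a) (f b) hab
  rwa [if_pos ⟨a, Setoid.refl' _ _⟩, hrf, hrf] at this

end SimplyConnected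

/-! ### Potentials on a group as crossed homomorphisms -/

section Potential

variable {G : Type*} [Group G]

/-- The action of `G` on functions `G → K` by right translation. -/
def translateHom (G K : Type*) [Group G] [Group K] : G →* MulAut (G → K) where
  toFun g :=
    { toFun := fun f a => f (a * g)
      invFun := fun f a => f (a * g⁻¹)
      left_inv := fun f => by ext; simp
      right_inv := fun f => by ext; simp
      map_mul' := fun _ _ => rfl }
  map_one' := by ext; simp
  map_mul' g h := by ext; simp [mul_assoc]

/-- Sections of the semidirect product are crossed homomorphisms with values in `G → K`. The
universal property glues those on the factors; evaluating the function part at `1` gives the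
potential. -/
theorem IsInternalFreeProduct.exists_potential {κ : Type*} {C : κ → Subgroup G}
    (hC : IsInternalFreeProduct C) {K : Type*} [Group K]
    (θ : ∀ k, C k →* (G → K) ⋊[translateHom G K] G) (hθ : ∀ k s, (θ k s).right = s) :
    ∃ P : G → K, ∀ k, ∀ s : C k, ∀ a, P (a * s) = P a * (θ k s).left a := by
  obtain ⟨Θ, hΘ⟩ := hC.exists_hom θ
  have hr : SemidirectProduct.rightHom.comp Θ = MonoidHom.id G :=
    MonoidHom.eq_of_iSup_eq_top hC.iSup_eq_top fun k a ha => by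
      have := hθ k ⟨a, ha⟩
      rw [← hΘ] at this
      exact this
  have hr' : ∀ a, (Θ a).right = a := fun a => DFunLike.congr_fun hr a
  refine ⟨fun a => (Θ a).left 1, fun k s a => ?_⟩
  beta_reduce
  rw [map_mul, SemidirectProduct.mul_left, hr', hΘ]
  simp [translateHom]

/-- After normalization at `1`, a function with constant increments along generators is
multiplicative. -/
theorem exists_hom_of_potential {K : Type*} [Group K] {κ : Type*} {d : κ → G}
    (hd : Subgroup.closure (Set.range d) = ⊤) {P : G → K} {f : κ → K}
    (hP : ∀ k g, P (g * d k) = P g * f k) : ∃ F : G →* K, ∀ k, F (d k) = f k := by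
  let Q : G → K := fun g => (P 1)⁻¹ * P g
  have hQ1 : Q 1 = 1 := by simp [Q]
  have hQd : ∀ k, Q (d k) = f k := fun k => by
    have := hP k 1
    rw [one_mul] at this
    simp [Q, this]
  have hQ : ∀ x g, Q (g * x) = Q g * Q x := by
    intro x
    have hx : x ∈ Subgroup.closure (Set.range d) := hd ▸ Subgroup.mem_top x
    induction hx using Subgroup.closure_induction with
    | mem x hx =>
      obtain ⟨k, rfl⟩ := hx
      intro g
      rw [hQd]
      simp [Q, hP, mul_assoc]
    | one => simp [hQ1]
    | mul x y _ _ hx hy =>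
      intro g
      rw [← mul_assoc, hy, hx, hy x, mul_assoc]
    | inv x _ hx =>
      intro g
      have h1 := hx (g * x⁻¹)
      have h2 := hx x⁻¹
      rw [inv_mul_cancel, hQ1] at h2
      rw [inv_mul_cancel_right] at h1
      rw [h1, mul_assoc, mul_eq_one_comm.1 h2.symm, mul_one]
  exact ⟨MonoidHom.mk' Q fun a b => hQ b a, hQd⟩

/-- This is the analogue of the Bass–Serre tree: the graph of elements and left cosets has no
cycles. A cocycle along the cosets of `B i` is exactly a crossed homomorphism on `B i`. -/
theorem IsInternalFreeProduct.hasPotentials {ι : Type*} {B : ι → Subgroup G}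
    (hB : IsInternalFreeProduct B) :
    HasPotentials.{w} fun i => QuotientGroup.leftRel (B i) := by
  intro K _ c hc
  obtain ⟨P, hP⟩ := hB.exists_potential (K := K)
    (fun i =>
      { toFun := fun s => ⟨fun a => c i a (a * s), s⟩
        map_one' := by
          ext a
          · simp [hc.self]
          · rfl
        map_mul' := fun s t => by
          ext a
          · simp only [Subgroup.coe_mul, SemidirectProduct.mul_left, Pi.mul_apply]
            refine (hc i a (a * s) (a * (s * t)) ?_ ?_).symm.trans ?_
            · simp [QuotientGroup.leftRel_apply]
            · simp [QuotientGroup.leftRel_apply, mul_assoc]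
            · simp [translateHom, mul_assoc]
          · rfl }) (fun _ _ => rfl)
  refine ⟨P, fun i a b hab => ?_⟩
  have := hP i ⟨a⁻¹ * b, QuotientGroup.leftRel_apply.1 hab⟩ a
  simpa using this.symm

end Potential

/-! ### Tree systems and contraction of edges -/

/-- A connected and simply connected family of `G`-invariant equivalence relations on the free
`G`-set `G × J`. -/
structure IsTreeSystem {G : Type*} [Group G] {J ι : Type*} (R : ι → Setoid (G × J)) : Prop where
  smul : ∀ i g a b, R i a b → R i (g * a.1, a.2) (g * b.1, b.2)
  connected : ∀ a b, EqvGen (fun a b => ∃ i, R i a b) a b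
  hasPotentials : HasPotentials.{w} R

namespace IsTreeSystem

variable {G : Type*} [Group G] {J ι : Type*} {R : ι → Setoid (G × J)}

/-- The stabilizer of the `R i`-class of `x`. -/
def stabilizer (hR : IsTreeSystem.{w} R) (i : ι) (x : G × J) : Subgroup G where
  carrier := {g | R i x (g * x.1, x.2)}
  one_mem' := by simp
  mul_mem' {a b} ha hb := by
    have h : R i (a * x.1, x.2) (a * b * x.1, x.2) := by
      simpa only [mul_assoc] using hR.smul i a _ _ hb
    exact Setoid.trans' _ ha h
  inv_mem' {a} ha := by
    have := hR.smul i a⁻¹ _ _ ha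
    simp only [inv_mul_cancel_left] at this
    exact Setoid.symm' _ this

theorem mem_stabilizer (hR : IsTreeSystem.{w} R) {i : ι} {x : G × J} {g : G} :
    g ∈ hR.stabilizer i x ↔ R i x (g * x.1, x.2) := Iff.rfl

theorem rel_iff_mem_stabilizer (hR : IsTreeSystem.{w} R) {i : ι} {x : G × J} {g h : G} :
    R i (g * x.1, x.2) (h * x.1, x.2) ↔ g⁻¹ * h ∈ hR.stabilizer i x := by
  rw [mem_stabilizer]
  constructor
  · intro hgh
    simpa [mul_assoc] using hR.smul i g⁻¹ _ _ hgh
  · intro hgh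
    simpa [mul_assoc] using hR.smul i g _ _ hgh

/-- Homomorphisms on the stabilizers form a cocycle on the single orbit, and its potential is their
common extension. -/
theorem isInternalFreeProduct {G : Type u} [Group G] {J : Type*} {ι : Type}
    {R : ι → Setoid (G × J)} (hR : IsTreeSystem.{u} R) [Subsingleton J] (x : G × J) :
    IsInternalFreeProduct fun i => hR.stabilizer i x := by
  classical
  -- The group element carrying `x` to `a`.
  let e : G × J → G := fun a => a.1 * x.1⁻¹
  have key : ∀ {i} {a b : G × J}, R i a b ↔ (e a)⁻¹ * e b ∈ hR.stabilizer i x := by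
    intro i a b
    rw [← hR.rel_iff_mem_stabilizer]
    have h : ∀ a : G × J, (e a * x.1, x.2) = a := fun a =>
      Prod.ext (by simp [e]) (Subsingleton.elim _ _)
    rw [h, h]
  have hsup : ⨆ i, hR.stabilizer i x = ⊤ := by
    rw [eq_top_iff]
    rintro g -
    have : ∀ a b, EqvGen (fun a b => ∃ i, R i a b) a b →
        (e a)⁻¹ * e b ∈ ⨆ i, hR.stabilizer i x := by
      intro a b h
      induction h with
      | rel a b h =>
        obtain ⟨i, h⟩ := h
        exact Subgroup.mem_iSup_of_mem i (key.1 h)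
      | refl a => simp
      | symm a b _ ih => simpa using inv_mem ih
      | trans a b d _ _ h h' => simpa [mul_assoc] using mul_mem h h'
    simpa [e] using this x (g * x.1, x.2) (hR.connected _ _)
  refine isInternalFreeProduct_of_exists_hom hsup fun K _ f => ?_
  obtain ⟨p, hp⟩ := hR.hasPotentials K
    (fun i a b => if h : (e a)⁻¹ * e b ∈ hR.stabilizer i x then f i ⟨_, h⟩ else 1) (by
      intro i a b d hab hbd
      have h1 := key.1 hab
      have h2 := key.1 hbd
      have h3 := key.1 (Setoid.trans' _ hab hbd)
      simp only [dif_pos h1, dif_pos h2, dif_pos h3]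
      rw [← map_mul]
      congr 1
      exact Subtype.ext (by simp only [Subgroup.coe_mul]; group))
  obtain ⟨F, hF⟩ := exists_hom_of_potential (κ := Σ i, hR.stabilizer i x)
    (d := fun s => s.2) (P := fun g => p (g * x.1, x.2)) (f := fun s => f s.1 s.2) (by
      rw [eq_top_iff, ← hsup, iSup_le_iff]
      exact fun i s hs => Subgroup.subset_closure ⟨⟨i, s, hs⟩, rfl⟩) (by
      rintro ⟨i, s⟩ g
      have h : (e (g * x.1, x.2))⁻¹ * e (g * s * x.1, x.2) = s := by simp [e]
      have h' : (e (g * x.1, x.2))⁻¹ * e (g * s * x.1, x.2) ∈ hR.stabilizer i x := by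
        rw [h]
        exact s.2
      have := hp i (g * x.1, x.2) (g * s * x.1, x.2) (key.2 h')
      rw [dif_pos h'] at this
      rw [← this]
      congr 2
      exact Subtype.ext h)
  exact ⟨F, fun i a => hF ⟨i, a⟩⟩

open Classical in
/-- The equivariant map removing the orbit `j₁` by sending `(1, j₁)` to `(t, j₀)`. -/
noncomputable def mergeMap (j₁ : J) (t : G) (j₀ : {j // j ≠ j₁}) (a : G × J) :
    G × {j // j ≠ j₁} :=
  if h : a.2 = j₁ then (a.1 * t, j₀) else (a.1, ⟨a.2, h⟩)

/-- The equivalence relations generated by the images of the `R i` under a map. -/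
def imageRel {X Y ι : Type*} (ρ : X → Y) (R : ι → Setoid X) (i : ι) : Setoid Y :=
  EqvGen.setoid fun a' b' => ∃ a b, ρ a = a' ∧ ρ b = b' ∧ R i a b

theorem imageRel_of {X Y ι : Type*} {ρ : X → Y} {R : ι → Setoid X} {i : ι} {a b : X}
    (h : R i a b) : imageRel ρ R i (ρ a) (ρ b) :=
  EqvGen.rel _ _ ⟨a, b, rfl, rfl, h⟩

theorem mergeMap_self {j₁ : J} {t : G} {j₀ : {j // j ≠ j₁}} (g : G) :
    mergeMap j₁ t j₀ (g, j₁) = (g * t, j₀) := by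
  simp [mergeMap]

theorem mergeMap_coe {j₁ : J} {t : G} {j₀ : {j // j ≠ j₁}} (a : G × {j // j ≠ j₁}) :
    mergeMap j₁ t j₀ (a.1, a.2) = a := by
  simp [mergeMap, a.2.2]

theorem mergeMap_smul {j₁ : J} {t : G} {j₀ : {j // j ≠ j₁}} (g : G) (a : G × J) :
    mergeMap j₁ t j₀ (g * a.1, a.2) =
      (g * (mergeMap j₁ t j₀ a).1, (mergeMap j₁ t j₀ a).2) := by
  simp only [mergeMap]
  split_ifs <;> simp [mul_assoc]

/-- The identified points already share a class, so contracting the edge between them creates no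
cycle. -/
theorem merge (hR : IsTreeSystem.{w} R) {j₁ : J} {t : G} {j₀ : {j // j ≠ j₁}} {μ : ι}
    (ht : R μ (1, j₁) (t, j₀)) : IsTreeSystem.{w} (imageRel (mergeMap j₁ t j₀) R) := by
  refine ⟨fun i g a b hab => ?_, fun a b => ?_, fun K _ c hc => ?_⟩
  · induction hab with
    | rel a b h =>
      obtain ⟨a, b, rfl, rfl, h⟩ := h
      rw [← mergeMap_smul, ← mergeMap_smul]
      exact imageRel_of (hR.smul i g a b h)
    | refl a => exact Setoid.refl' _ _
    | symm a b _ ih => exact Setoid.symm' _ ih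
    | trans a b d _ _ h h' => exact Setoid.trans' _ h h'
  · rw [← mergeMap_coe (t := t) (j₀ := j₀) a, ← mergeMap_coe (t := t) (j₀ := j₀) b]
    generalize ((a.1, a.2.1) : G × J) = a, ((b.1, b.2.1) : G × J) = b
    induction hR.connected a b with
    | rel a b h =>
      obtain ⟨i, h⟩ := h
      exact EqvGen.rel _ _ ⟨i, imageRel_of h⟩
    | refl a => exact EqvGen.refl _
    | symm a b _ ih => exact EqvGen.symm _ _ ih
    | trans a b d _ _ h h' => exact EqvGen.trans _ _ _ h h'
  · obtain ⟨p, hp⟩ := hR.hasPotentials K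
      (fun i a b => c i (mergeMap j₁ t j₀ a) (mergeMap j₁ t j₀ b))
      (fun i a b d hab hbd => hc i _ _ _ (imageRel_of hab) (imageRel_of hbd))
    -- The pulled-back cocycle is `1` on contracted edges, so its potential is constant on the
    -- fibres of the merge and descends.
    have hpρ : ∀ a, p ((mergeMap j₁ t j₀ a).1, (mergeMap j₁ t j₀ a).2) = p a := by
      rintro ⟨g, j⟩
      by_cases hj : j = j₁
      · subst hj
        have h := hR.smul μ g _ _ ht
        simp only [mul_one] at h
        have h1 := hp μ _ _ h
        have h2 := mergeMap_coe (j₁ := j) (t := t) (j₀ := j₀) (g * t, j₀)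
        simp only [mergeMap_self, h2, hc.self, mul_one] at h1 ⊢
        exact h1.symm
      · simp [mergeMap, hj]
    refine ⟨fun a => p (a.1, a.2), fun i a b hab => ?_⟩
    refine hc.potential_of_eqvGen (p := fun a => p (a.1, a.2)) (fun a b h => ?_) ?_ hab
    · exact EqvGen.rel _ _ h
    · rintro _ _ ⟨a, b, rfl, rfl, h⟩
      simp only [hpρ]
      exact hp i a b h

end IsTreeSystem

theorem eqvGen_map {X Y : Type*} {r : X → X → Prop} {s : Y → Y → Prop} (f : X → Y)
    (h : ∀ a b, r a b → EqvGen s (f a) (f b)) {a b : X} (hab : EqvGen r a b) :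
    EqvGen s (f a) (f b) := by
  induction hab with
  | rel a b hab => exact h a b hab
  | refl a => exact EqvGen.refl _
  | symm a b _ ih => exact EqvGen.symm _ _ ih
  | trans a b d _ _ h h' => exact EqvGen.trans _ _ _ h h'

theorem nonempty_mulEquiv_zpowers {G : Type*} [Group G] {t : G}
    (ht : Function.Injective fun n : ℤ => t ^ n) :
    Nonempty (Multiplicative ℤ ≃* Subgroup.zpowers t) :=
  ⟨MulEquiv.ofBijective ((zpowersHom G t).codRestrict (Subgroup.zpowers t)
      fun n => Subgroup.mem_zpowers_iff.2 ⟨n.toAdd, by simp⟩)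
    ⟨fun m n hmn => Multiplicative.toAdd.injective
      (ht (by simpa using congrArg Subtype.val hmn)), by
      rintro ⟨_, n, rfl⟩
      exact ⟨Multiplicative.ofAdd n, by ext; simp⟩⟩⟩

/-! ### Indecomposable groups fix a class -/

/-- An indecomposable group acting on a simply connected system with two free orbits joined by an
edge orbit and a single further equivalence relation fixes a class of that relation. -/
theorem IsIndecomposableGroup.exists_fixed_class_of_two_orbits {G : Type u} [Group G]
    (hG : IsIndecomposableGroup G) (S : Setoid (G × Bool))
    (hS : ∀ g a b, S a b → S (g * a.1, a.2) (g * b.1, b.2))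
    (hP : ∀ (K : Type u) [Group K] (c : G × Bool → G × Bool → K),
      (∀ a b d, S a b → S b d → c a b * c b d = c a d) →
      ∃ p : G × Bool → K, (∀ g, p (g, false) = p (g, true)) ∧ ∀ a b, S a b → p a * c a b = p b)
    (hD : Subgroup.closure {k | ∃ β γ, S (1, β) (k, γ)} = ⊤) :
    ∃ β, ∀ g, S (1, β) (g, β) := by
  classical
  let T : Bool → Subgroup G := fun β =>
    { carrier := {g | S (1, β) (g, β)}
      one_mem' := Setoid.refl' S _
      mul_mem' := fun {a b} ha hb => by
        have h := hS a _ _ hb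
        simp only [mul_one] at h
        exact Setoid.trans' _ ha h
      inv_mem' := fun {a} ha => by
        have h := hS a⁻¹ _ _ ha
        simp only [mul_one, inv_mul_cancel] at h
        exact Setoid.symm' _ h }
  have hT : ∀ {β g h}, S (g, β) (h, β) ↔ g⁻¹ * h ∈ T β := fun {β g h} =>
    ⟨fun H => by
      have h1 := hS g⁻¹ _ _ H
      simp only [inv_mul_cancel] at h1
      exact h1, fun H => by
      have h1 := hS g _ _ H
      simp only [mul_one, mul_inv_cancel_left] at h1
      exact h1⟩
  -- If `S` links the two orbits, the edges form a loop in the quotient, so `G` would be `T false`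
  -- times a free cyclic factor `⟨t⟩`. Otherwise `G` is the free product of the two stabilizers.
  by_cases hB : ∃ t, S (1, true) (t, false)
  · exfalso
    obtain ⟨t, ht⟩ := hB
    let e : G × Bool → G := fun a => if a.2 then a.1 * t else a.1
    have he : ∀ a, S a (e a, false) := by
      rintro ⟨g, _ | _⟩
      · exact Setoid.refl' _ _
      · simpa [e] using hS g _ _ ht
    have heT : ∀ {a b}, S a b → (e a)⁻¹ * e b ∈ T false := fun {a b} h =>
      hT.1 (Setoid.trans' _ (Setoid.symm' _ (he a)) (Setoid.trans' _ h (he b)))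
    have hgen : Subgroup.closure (Set.range (Sum.elim (fun s : T false => (s : G))
        (fun _ : Unit => t))) = ⊤ := by
      rw [eq_top_iff, ← hD, Subgroup.closure_le]
      rintro k ⟨β, γ, hk⟩
      have h1 := heT hk
      have ht' : t ∈ Subgroup.closure (Set.range (Sum.elim (fun s : T false => (s : G))
        (fun _ : Unit => t))) := Subgroup.subset_closure ⟨Sum.inr (), rfl⟩
      have hs : ∀ s ∈ T false, s ∈ Subgroup.closure (Set.range (Sum.elim
        (fun s : T false => (s : G)) (fun _ : Unit => t))) :=
        fun s hs => Subgroup.subset_closure ⟨Sum.inl ⟨s, hs⟩, rfl⟩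
      have h2 := hs _ h1
      have hk' : k = e (1, β) * ((e (1, β))⁻¹ * e (k, γ)) * (if γ then t⁻¹ else 1) := by
        cases γ <;> simp [e]
      rw [hk']
      refine mul_mem (mul_mem ?_ h2) ?_
      · cases β
        · simp [e]
        · simpa [e] using ht'
      · cases γ
        · simp
        · simpa using ht'
    have hext : ∀ (K : Type u) [Group K] (f : T false →* K) (τ : K),
        ∃ F : G →* K, (∀ s : T false, F s = f s) ∧ F t = τ := by
      intro K _ f τ
      let f' : G → K := fun s => if h : s ∈ T false then f ⟨s, h⟩ else 1
      have hf' : ∀ s : T false, f' s = f s := fun s => by simp [f']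
      have hmul : ∀ {r s}, r ∈ T false → s ∈ T false → f' r * f' s = f' (r * s) :=
        fun {r s} hr hs => by
          rw [hf' ⟨r, hr⟩, hf' ⟨s, hs⟩, ← map_mul, ← hf']
          rfl
      -- Twisting by `k` gives the step from `(g, true)` to `(g * t, false)` the value `τ`; as `p`
      -- agrees on `(g, false)` and `(g, true)`, `t` is then sent to `τ`.
      let k : G × Bool → K := fun a => if a.2 then τ else 1
      obtain ⟨p, hp, hp'⟩ := hP K (fun a b => k a * f' ((e a)⁻¹ * e b) * (k b)⁻¹)
        (fun a b d hab hbd => by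
          have := hmul (heT hab) (heT hbd)
          rw [show (e a)⁻¹ * e b * ((e b)⁻¹ * e d) = (e a)⁻¹ * e d by group] at this
          rw [← this]
          group)
      obtain ⟨F, hF⟩ := exists_hom_of_potential hgen (P := fun g => p (g, false))
        (f := Sum.elim f (fun _ => τ)) (by
          rintro (s | _) g
          · have h : S (g, false) (g * s, false) := hT.2 (by simp)
            have h1 := hp' _ _ h
            simp only [k, e] at h1
            simp only [Sum.elim_inl, ← h1]
            simp [hf']
          · have h : S (g, true) (g * t, false) := by simpa using hS g _ _ ht
            have h1 := hp' _ _ h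
            simp only [Sum.elim_inr, ← h1, hp]
            have h2 : f' 1 = 1 := by simpa using hf' 1
            simp [k, e, h2])
      exact ⟨F, fun s => hF (Sum.inl s), hF (Sum.inr ())⟩
    obtain ⟨F, -, hF⟩ := hext (ULift (Multiplicative ℤ)) 1 ⟨Multiplicative.ofAdd 1⟩
    have htinj : Function.Injective fun n : ℤ => t ^ n := by
      intro m n hmn
      have := congrArg (fun x => (F x).down.toAdd) hmn
      simpa [hF, ULift.pow_down] using this
    obtain ⟨eZ⟩ := nonempty_mulEquiv_zpowers htinj
    have hprod : IsInternalFreeProduct (![T false, Subgroup.zpowers t] : Fin 2 → Subgroup G) := by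
      refine isInternalFreeProduct_of_exists_hom ?_ fun K _ f => ?_
      · rw [iSup_fin_two_eq, eq_top_iff, ← hgen, Subgroup.closure_le]
        rintro _ ⟨s | _, rfl⟩
        · exact Subgroup.mem_sup_left s.2
        · exact Subgroup.mem_sup_right (Subgroup.mem_zpowers t)
      · obtain ⟨F, hF, hF'⟩ := hext K (f 0) (f 1 ⟨t, Subgroup.mem_zpowers t⟩)
        refine ⟨F, fun i => ?_⟩
        fin_cases i
        · exact hF
        · rintro ⟨_, n, rfl⟩
          have h : (⟨t ^ n, n, rfl⟩ : Subgroup.zpowers t) = ⟨t, Subgroup.mem_zpowers t⟩ ^ n := by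
            ext
            simp
          refine (map_zpow F t n).trans ?_
          rw [hF', ← map_zpow]
          exact congrArg (f 1) h.symm
    obtain ⟨i', hi'⟩ := hG.not_free_product _ hprod
    have ht1 : Subgroup.zpowers t ≠ ⊥ := by
      rw [Ne, Subgroup.zpowers_eq_bot]
      intro h
      have := @htinj 0 1 (by simp [h])
      simp at this
    have hi0 : T false = ⊥ := by
      fin_cases i'
      · exact hi'
      · exact absurd hi' ht1
    have htop : Subgroup.zpowers t = ⊤ := by
      have := hprod.iSup_eq_top
      rw [iSup_fin_two_eq] at this
      simpa [hi0] using this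
    exact hG.not_infinite_cyclic
      ⟨(Subgroup.topEquiv.symm.trans (MulEquiv.subgroupCongr htop.symm)).trans eZ.symm⟩
  · have hne : ∀ {g h}, ¬ S (g, true) (h, false) := fun {g h} H =>
      hB ⟨g⁻¹ * h, by simpa using hS g⁻¹ _ _ H⟩
    have hββ : ∀ {a b}, S a b → b.2 = a.2 := by
      rintro ⟨g, _ | _⟩ ⟨h, _ | _⟩ H
      · rfl
      · exact absurd (Setoid.symm' _ H) hne
      · exact absurd H hne
      · rfl
    have hST : ∀ {a b}, S a b → a.1⁻¹ * b.1 ∈ T a.2 := by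
      rintro ⟨g, β⟩ ⟨h, γ⟩ H
      obtain rfl : γ = β := hββ H
      exact hT.1 H
    have hprod : IsInternalFreeProduct (![T false, T true] : Fin 2 → Subgroup G) := by
      have hgen : Subgroup.closure (Set.range (fun s : Σ β, T β => (s.2 : G))) = ⊤ := by
        rw [eq_top_iff, ← hD, Subgroup.closure_le]
        rintro k ⟨β, γ, hk⟩
        exact Subgroup.subset_closure ⟨⟨β, k, by simpa using hST hk⟩, rfl⟩
      refine isInternalFreeProduct_of_exists_hom ?_ fun K _ f => ?_
      · rw [iSup_fin_two_eq, eq_top_iff, ← hgen, Subgroup.closure_le]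
        rintro _ ⟨⟨_ | _, s⟩, rfl⟩
        · exact Subgroup.mem_sup_left s.2
        · exact Subgroup.mem_sup_right s.2
      · let φ : ∀ β, T β →* K := fun β => match β with
          | false => f 0
          | true => f 1
        let f' : Bool → G → K := fun β s => if h : s ∈ T β then φ β ⟨s, h⟩ else 1
        have hf' : ∀ β (s : T β), f' β s = φ β s := fun β s => by simp [f']
        have hmul : ∀ {β r s}, r ∈ T β → s ∈ T β → f' β r * f' β s = f' β (r * s) :=
          fun {β r s} hr hs => by
            rw [hf' β ⟨r, hr⟩, hf' β ⟨s, hs⟩, ← map_mul, ← hf']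
            rfl
        obtain ⟨p, hp, hp'⟩ := hP K (fun a b => f' a.2 (a.1⁻¹ * b.1)) (fun a b d hab hbd => by
          have h1 := hST hbd
          rw [hββ hab] at h1 ⊢
          rw [hmul (hST hab) h1]
          congr 1
          group)
        obtain ⟨F, hF⟩ := exists_hom_of_potential hgen (P := fun g => p (g, false))
          (f := fun s => φ s.1 s.2) (by
            rintro ⟨β, s⟩ g
            have h : S (g, β) (g * s, β) := hT.2 (by simp)
            have h1 := hp' _ _ h
            simp only [inv_mul_cancel_left, hf'] at h1
            cases β
            · exact h1.symm
            · simp only [hp]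
              exact h1.symm)
        refine ⟨F, fun i => ?_⟩
        fin_cases i
        · exact fun s => hF ⟨false, s⟩
        · exact fun s => hF ⟨true, s⟩
    obtain ⟨i, hi⟩ := hG.exists_eq_top hprod
    fin_cases i
    · exact ⟨false, fun g => (Subgroup.eq_top_iff' (T false)).1 hi g⟩
    · exact ⟨true, fun g => (Subgroup.eq_top_iff' (T true)).1 hi g⟩

theorem IsTreeSystem.exists_rel_of_ne {G J ι : Type*} [Group G] {R : ι → Setoid (G × J)}
    (hR : IsTreeSystem.{w} R) [Nontrivial J] :
    ∃ (μ : ι) (j₁ : J) (t : G) (j₀ : {j // j ≠ j₁}), R μ (1, j₁) (t, j₀) := by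
  by_contra! H
  have h : ∀ i a b, R i a b → a.2 = b.2 := by
    intro i a b hab
    by_contra hne
    refine H i a.2 (a.1⁻¹ * b.1) ⟨b.2, Ne.symm hne⟩ ?_
    simpa using hR.smul i a.1⁻¹ a b hab
  have h' : ∀ a b, EqvGen (fun a b => ∃ i, R i a b) a b → a.2 = b.2 := by
    intro a b hab
    induction hab with
    | rel a b hab => exact h _ a b hab.choose_spec
    | refl a => rfl
    | symm a b _ ih => exact ih.symm
    | trans a b d _ _ h h' => exact h.trans h'
  obtain ⟨j, j', hj⟩ := exists_pair_ne J
  exact hj (h' (1, j) (1, j') (hR.connected _ _))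

/-- Undoes a contraction. A fixed class of the image relation is a union of `R i`-classes joined by
contracted edges; `G` acts on this subtree, to which the case of two orbits applies. -/
theorem IsIndecomposableGroup.exists_fixed_class_of_merge {G : Type u} [Group G]
    (hG : IsIndecomposableGroup G) {J : Type v} {ι : Type} {R : ι → Setoid (G × J)}
    (hR : IsTreeSystem.{u} R) {μ i : ι} {j₁ : J} {t : G} {j₀ : {j // j ≠ j₁}}
    (ht : R μ (1, j₁) (t, j₀)) {x : G × {j // j ≠ j₁}}
    (hx : ∀ g, IsTreeSystem.imageRel (IsTreeSystem.mergeMap j₁ t j₀) R i x (g * x.1, x.2)) :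
    ∃ z : G × J, ∀ g, R i z (g * z.1, z.2) := by
  classical
  let pt : Bool → G × J := fun β => if β then (1, j₁) else (t, j₀)
  by_cases hi : i = μ
  · subst hi
    have key : ∀ a b, IsTreeSystem.imageRel (IsTreeSystem.mergeMap j₁ t j₀) R i a b →
        R i (a.1, a.2) (b.1, b.2) := by
      intro a b hab
      have h1 : ∀ a : G × J, R i a ((IsTreeSystem.mergeMap j₁ t j₀ a).1,
          (IsTreeSystem.mergeMap j₁ t j₀ a).2) := by
        rintro ⟨g, j⟩
        by_cases hj : j = j₁
        · subst hj
          rw [IsTreeSystem.mergeMap_self]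
          simpa using hR.smul i g _ _ ht
        · simp [IsTreeSystem.mergeMap, hj]
      induction hab with
      | rel a b h =>
        obtain ⟨a, b, rfl, rfl, h⟩ := h
        exact Setoid.trans' _ (Setoid.symm' _ (h1 a)) (Setoid.trans' _ h (h1 b))
      | refl a => exact Setoid.refl' _ _
      | symm a b _ ih => exact Setoid.symm' _ ih
      | trans a b d _ _ h h' => exact Setoid.trans' _ h h'
    exact ⟨(x.1, x.2), fun g => key _ _ (hx g)⟩
  let act : G → G × J → G × J := fun g a => (g * a.1, a.2)
  have act_act : ∀ g h a, act g (act h a) = act (g * h) a := fun g h a => by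
    simp [act, mul_assoc]
  have act_one : ∀ a, act 1 a = a := fun a => by simp [act]
  have smul : ∀ {g a b}, R i a b → R i (act g a) (act g b) := fun {g a b} h => hR.smul i g a b h
  let D : Subgroup G := Subgroup.closure {k | ∃ β γ, R i (pt β) (act k (pt γ))}
  have hD : ∀ {g h β γ}, R i (act g (pt β)) (act h (pt γ)) → g⁻¹ * h ∈ D := by
    intro g h β γ H
    refine Subgroup.subset_closure ⟨β, γ, ?_⟩
    have := smul (g := g⁻¹) H
    simpa only [act_act, inv_mul_cancel, act_one] using this
  -- `W` enlarges `R i` by passage along translates of the contracted edge; `D` consists of the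
  -- translations obtained by alternating such edges with `R i`-steps.
  let W : G × J → G × J → Prop := fun a b => R i a b ∨ ∃ g h β γ, g⁻¹ * h ∈ D ∧
    R i a (act g (pt β)) ∧ R i b (act h (pt γ))
  have W_symm : ∀ {a b}, W a b → W b a := by
    rintro a b (h | ⟨g, h, β, γ, hgh, ha, hb⟩)
    · exact Or.inl (Setoid.symm' _ h)
    · exact Or.inr ⟨h, g, γ, β, by simpa using inv_mem hgh, hb, ha⟩
  have W_trans : ∀ {a b d}, W a b → W b d → W a d := by
    rintro a b d (h | ⟨g, h, β, γ, hgh, ha, hb⟩) (h' | ⟨g', h', β', γ', hgh', hb', hd⟩)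
    · exact Or.inl (Setoid.trans' _ h h')
    · exact Or.inr ⟨g', h', β', γ', hgh', Setoid.trans' _ h hb', hd⟩
    · exact Or.inr ⟨g, h, β, γ, hgh, ha, Setoid.trans' _ (Setoid.symm' _ h') hb⟩
    · refine Or.inr ⟨g, h', β, γ', ?_, ha, hd⟩
      have h1 := hD (Setoid.trans' _ (Setoid.symm' _ hb) hb')
      have h2 := mul_mem (mul_mem hgh h1) hgh'
      simpa [mul_assoc] using h2
  have W_smul : ∀ {g a b}, W a b → W (act g a) (act g b) := by
    rintro k a b (h | ⟨g, h, β, γ, hgh, ha, hb⟩)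
    · exact Or.inl (smul h)
    · refine Or.inr ⟨k * g, k * h, β, γ, by simpa [mul_assoc] using hgh, ?_, ?_⟩
      · simpa only [act_act] using smul (g := k) ha
      · simpa only [act_act] using smul (g := k) hb
  have hWρ : ∀ a : G × J, W ((IsTreeSystem.mergeMap j₁ t j₀ a).1,
      (IsTreeSystem.mergeMap j₁ t j₀ a).2) a := by
    rintro ⟨g, j⟩
    by_cases hj : j = j₁
    · subst hj
      rw [IsTreeSystem.mergeMap_self]
      refine Or.inr ⟨g, g, false, true, by simp, ?_, ?_⟩
      · exact Setoid.refl' _ _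
      · simp [act, pt]
    · rw [show IsTreeSystem.mergeMap j₁ t j₀ (g, j) = (g, ⟨j, hj⟩) by
        simp [IsTreeSystem.mergeMap, hj]]
      exact Or.inl (Setoid.refl' _ _)
  have key : ∀ a b, IsTreeSystem.imageRel (IsTreeSystem.mergeMap j₁ t j₀) R i a b →
      W (a.1, a.2) (b.1, b.2) := by
    intro a b hab
    induction hab with
    | rel a b h =>
      obtain ⟨a, b, rfl, rfl, h⟩ := h
      exact W_trans (hWρ a) (W_trans (Or.inl h) (W_symm (hWρ b)))
    | refl a => exact Or.inl (Setoid.refl' _ _)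
    | symm a b _ ih => exact W_symm ih
    | trans a b d _ _ h h' => exact W_trans h h'
  set z : G × J := (x.1, x.2) with hz
  have hWz : ∀ g, W z (act g z) := fun g => key _ _ (hx g)
  by_cases hfix : ∀ g, R i z (act g z)
  · exact ⟨z, hfix⟩
  push Not at hfix
  obtain ⟨g₀, hg₀⟩ := hfix
  obtain ⟨g₁, β, hβ⟩ : ∃ g₁ β, R i z (act g₁ (pt β)) := by
    rcases hWz g₀ with h | ⟨g, h, β, γ, -, ha, -⟩
    · exact absurd h hg₀
    · exact ⟨g, β, ha⟩
  have hWpt : ∀ h, W (pt β) (act h (pt β)) := by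
    intro h
    have h1 : W (pt β) (act g₁⁻¹ z) := W_symm <| by
      simpa only [act_act, inv_mul_cancel, act_one] using W_smul (g := g₁⁻¹) (Or.inl hβ)
    have h2 : W (act g₁⁻¹ z) (act (h * g₁⁻¹) z) := by
      simpa [act_act, mul_assoc] using W_smul (g := g₁⁻¹) (hWz (g₁ * h * g₁⁻¹))
    have h3 := W_symm (W_smul (g := h) h1)
    rw [act_act] at h3
    exact W_trans h1 (W_trans h2 h3)
  -- Connectivity of the fixed subtree: `pt β` and all its translates lie in one `W`-class.
  have hDtop : D = ⊤ := by
    rw [Subgroup.eq_top_iff']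
    intro h
    rcases hWpt h with h1 | ⟨g, h', γ, γ', hgh, ha, hb⟩
    · exact Subgroup.subset_closure ⟨β, β, h1⟩
    · have h1 : g ∈ D := Subgroup.subset_closure ⟨β, γ, ha⟩
      have h2 := hD hb
      have h3 := mul_mem (mul_mem h1 hgh) (inv_mem h2)
      simpa [mul_assoc] using h3
  let f : G × Bool → G × J := fun a => act a.1 (pt a.2)
  have hf : Function.Injective f := by
    rintro ⟨g, _ | _⟩ ⟨h, _ | _⟩ H
    · simpa [f, act, pt] using H
    · have := congrArg Prod.snd H
      simp [f, act, pt, j₀.2] at this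
    · have := congrArg Prod.snd H
      simp [f, act, pt, Ne.symm j₀.2] at this
    · simpa [f, act, pt] using H
  obtain ⟨β, hβ⟩ := hG.exists_fixed_class_of_two_orbits ((R i).comap f)
    (fun g a b hab => by
      have : R i (act g (f a)) (act g (f b)) := smul hab
      change R i (act (g * a.1) (pt a.2)) (act (g * b.1) (pt b.2))
      simpa only [f, act_act] using this)
    (fun K _ c hc => by
      -- The cocycle is trivial off `i`, and `μ ≠ i`, so the potential takes equal values at the two
      -- ends of a contracted edge.
      obtain ⟨p, hp⟩ := hR.hasPotentials.comap hf K (fun ν a b => if ν = i then c a b else 1)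
        (by
          intro ν a b d hab hbd
          by_cases hν : ν = i
          · subst hν
            simpa using hc a b d hab hbd
          · simp [hν])
      refine ⟨p, fun g => ?_, fun a b hab => by simpa using hp i a b hab⟩
      have h1 : R μ (f (g, true)) (f (g, false)) := by
        simpa [f, act, pt] using hR.smul μ g _ _ ht
      have h2 := hp μ _ _ h1
      simpa [Ne.symm hi] using h2.symm)
    (by
      rw [← hDtop]
      congr 1
      ext k
      refine exists_congr fun β => exists_congr fun γ => ?_
      change R i (act 1 (pt β)) _ ↔ _
      rw [act_one])
  refine ⟨pt β, fun g => ?_⟩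
  have : R i (act 1 (pt β)) (act g (pt β)) := hβ g
  rwa [act_one] at this

/-- Induction on the number of orbits. For one orbit the stabilizers are free factors, so one of
them is all of `G`. -/
theorem IsIndecomposableGroup.exists_fixed_class {G : Type u} [Group G]
    (hG : IsIndecomposableGroup G) {ι : Type} (n : ℕ) :
    ∀ {J : Type v} [Finite J] [Nonempty J], Nat.card J = n → ∀ {R : ι → Setoid (G × J)},
      IsTreeSystem.{u} R → ∃ i, ∃ x : G × J, ∀ g, R i x (g * x.1, x.2) := by
  induction n with
  | zero =>
    intro J _ _ hJ
    exact absurd hJ Nat.card_pos.ne'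
  | succ n ih =>
    intro J _ _ hJ R hR
    rcases subsingleton_or_nontrivial J with hJ' | hJ'
    · obtain ⟨j⟩ := ‹Nonempty J›
      obtain ⟨i, hi⟩ := hG.exists_eq_top (hR.isInternalFreeProduct (1, j))
      exact ⟨i, (1, j), fun g => hR.mem_stabilizer.1 (hi ▸ Subgroup.mem_top g)⟩
    · obtain ⟨μ, j₁, t, j₀, ht⟩ := hR.exists_rel_of_ne
      have : Nonempty {j // j ≠ j₁} := ⟨j₀⟩
      obtain ⟨i, x, hx⟩ := ih (J := {j // j ≠ j₁}) (by
        have := Set.ncard_sdiff_singleton_of_mem (Set.mem_univ j₁)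
        rw [Set.ncard_univ, hJ] at this
        rw [← Nat.card_coe_set_eq] at this
        rw [← Nat.add_sub_cancel (n := n) (m := 1), ← this]
        exact Nat.card_congr (Equiv.subtypeEquivRight (by simp))) (hR.merge ht)
      exact ⟨i, hG.exists_fixed_class_of_merge hR ht hx⟩

/-! ### Indecomposable subgroups of free products -/

/-- A finite subset of `H` lies in a finite subset that is connected through the cosets of the
subgroups `B i`. -/
theorem exists_finite_connected {H : Type*} [Group H] {ι : Type*} {B : ι → Subgroup H}
    (hB : ⨆ i, B i = ⊤) {F : Set H} (hF : F.Finite) :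
    ∃ V : Set H, V.Finite ∧ F ⊆ V ∧ ∃ h1 : (1 : H) ∈ V,
      ∀ v : V, EqvGen (fun a b : V => ∃ i, (a : H)⁻¹ * b ∈ B i) ⟨1, h1⟩ v := by
  have single : ∀ h : H, ∃ V : Set H, V.Finite ∧ h ∈ V ∧ ∃ h1 : (1 : H) ∈ V,
      ∀ v : V, EqvGen (fun a b : V => ∃ i, (a : H)⁻¹ * b ∈ B i) ⟨1, h1⟩ v := by
    intro h
    have hh : h ∈ ⨆ i, B i := hB ▸ Subgroup.mem_top h
    induction hh using Subgroup.iSup_induction' with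
    | hp i x hx =>
      refine ⟨{1, x}, by simp, by simp, by simp, ?_⟩
      rintro ⟨v, rfl | hv⟩
      · exact EqvGen.refl _
      · obtain rfl : v = x := hv
        exact EqvGen.rel _ _ ⟨i, by simpa using hx⟩
    | h1 =>
      refine ⟨{1}, by simp, by simp, by simp, ?_⟩
      rintro ⟨v, hv⟩
      obtain rfl : v = 1 := hv
      exact EqvGen.refl _
    | hmul x y _ _ hx hy =>
      obtain ⟨V, hV, hxV, h1, hconn⟩ := hx
      obtain ⟨V', hV', hyV', h1', hconn'⟩ := hy
      let l : V → ↥(V ∪ (x * ·) '' V') := fun v => ⟨v, Or.inl v.2⟩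
      let r : V' → ↥(V ∪ (x * ·) '' V') := fun v => ⟨x * v, Or.inr ⟨v, v.2, rfl⟩⟩
      have hl := fun v => eqvGen_map
        (s := fun a b : ↥(V ∪ (x * ·) '' V') => ∃ i, (a : H)⁻¹ * b ∈ B i) l
        (fun a b h => EqvGen.rel _ _ h) (hconn v)
      have hr := fun v => eqvGen_map
        (s := fun a b : ↥(V ∪ (x * ·) '' V') => ∃ i, (a : H)⁻¹ * b ∈ B i) r
        (fun a b h => EqvGen.rel _ _ (by simpa [r, mul_assoc] using h)) (hconn' v)
      refine ⟨V ∪ (x * ·) '' V', hV.union (hV'.image _), Or.inr ⟨y, hyV', rfl⟩, Or.inl h1, ?_⟩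
      rintro ⟨_, hv | ⟨v, hv, rfl⟩⟩
      · exact hl ⟨_, hv⟩
      · refine EqvGen.trans _ _ _ (hl ⟨x, hxV⟩) ?_
        have := hr ⟨v, hv⟩
        rwa [show r ⟨1, h1'⟩ = l ⟨x, hxV⟩ from Subtype.ext (mul_one x)] at this
  choose V hV hhV h1 hconn using single
  refine ⟨⋃ h ∈ insert 1 F, V h, (hF.insert 1).biUnion fun h _ => hV h, fun h hh =>
    Set.mem_biUnion (Or.inr hh) (hhV h), Set.mem_biUnion (Or.inl rfl) (h1 1), ?_⟩
  rintro ⟨v, hv⟩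
  obtain ⟨h, hh, hvh⟩ := Set.mem_iUnion₂.1 hv
  exact eqvGen_map
    (s := fun a b : ↥(⋃ h ∈ insert 1 F, V h) => ∃ i, (a : H)⁻¹ * b ∈ B i)
    (fun v : V h => (⟨v, Set.mem_biUnion hh v.2⟩ : ↥(⋃ h ∈ insert 1 F, V h)))
    (fun a b h => EqvGen.rel _ _ h) (hconn h ⟨v, hvh⟩)

/-- An indecomposable finitely generated subgroup of a free product is conjugate into a factor. -/
theorem IsInternalFreeProduct.exists_conj_mem {H : Type u} [Group H] {ι : Type}
    {B : ι → Subgroup H} (hB : IsInternalFreeProduct B) {L : Subgroup H} [Group.FG L]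
    (hL : IsIndecomposableGroup L) : ∃ i, ∃ h : H, ∀ l ∈ L, h⁻¹ * l * h ∈ B i := by
  obtain ⟨S, hS, hSfin⟩ := Group.fg_iff.1 ‹Group.FG L›
  obtain ⟨V, hV, hSV, h1, hconn⟩ := exists_finite_connected hB.iSup_eq_top
    (hSfin.image (Subtype.val : L → H))
  let Q := Quotient (QuotientGroup.rightRel L)
  let q : H → Q := Quotient.mk _
  let J : Set Q := q '' V
  have : Finite J := hV.image q
  have : Nonempty J := ⟨⟨q 1, 1, h1, rfl⟩⟩
  -- Identifies `L × J` with `L * V`, a union of finitely many free `L`-orbits in `H`; `V` contains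
  -- generators of `L`, so this part of the forest of cosets is connected. A fixed class lies in a
  -- coset `f x * B i`, which gives the conjugation.
  let f : L × J → H := fun a => a.1 * a.2.1.out
  have hq : ∀ a, q (f a) = a.2 := by
    rintro ⟨l, j⟩
    conv_rhs => rw [← j.1.out_eq]
    refine Quotient.sound ?_
    change QuotientGroup.rightRel L _ _
    rw [QuotientGroup.rightRel_apply]
    simp [f]
  have hf : Function.Injective f := by
    intro a b hab
    have h : a.2 = b.2 := Subtype.ext (by rw [← hq, ← hq, hab])
    refine Prod.ext ?_ h
    have hab' : (a.1 : H) * a.2.1.out = b.1 * b.2.1.out := hab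
    rw [h] at hab'
    exact Subtype.ext (mul_right_cancel hab')
  have hsurj : ∀ (l : L) (v : V), ∃ a, f a = l * v := by
    intro l v
    have h : (v : H) * (q v).out⁻¹ ∈ L :=
      QuotientGroup.rightRel_apply.1 (Quotient.exact (q v).out_eq)
    refine ⟨(l * ⟨_, h⟩, ⟨q v, v, v.2, rfl⟩), ?_⟩
    simp [f, mul_assoc]
  choose pt hpt using hsurj
  have hf_smul : ∀ (l : L) (a : L × J), f (l * a.1, a.2) = l * f a := fun l a => by
    simp [f, mul_assoc]
  have hR : IsTreeSystem.{u} fun i => (QuotientGroup.leftRel (B i)).comap f := by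
    refine ⟨fun i l a b hab => ?_, ?_, hB.hasPotentials.comap hf⟩
    · change QuotientGroup.leftRel (B i) _ _ at hab ⊢
      rw [QuotientGroup.leftRel_apply] at hab ⊢
      rw [hf_smul, hf_smul]
      simpa [mul_assoc] using hab
    · let C : L × J → L × J → Prop :=
        EqvGen fun a b => ∃ i, ((QuotientGroup.leftRel (B i)).comap f) a b
      have C_symm : ∀ {a b}, C a b → C b a := fun h => EqvGen.symm _ _ h
      have C_trans : ∀ {a b d}, C a b → C b d → C a d := fun h h' => EqvGen.trans _ _ _ h h'
      have hV : ∀ l v, C (pt l ⟨1, h1⟩) (pt l v) := fun l v =>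
        eqvGen_map (pt l) (fun a b ⟨i, h⟩ => EqvGen.rel _ _ ⟨i, by
          change QuotientGroup.leftRel (B i) _ _
          rw [QuotientGroup.leftRel_apply, hpt, hpt]
          simpa [mul_assoc] using h⟩) (hconn v)
      have hL : ∀ l l', C (pt l' ⟨1, h1⟩) (pt (l' * l) ⟨1, h1⟩) := by
        intro l
        have hl : l ∈ Subgroup.closure S := hS ▸ Subgroup.mem_top l
        induction hl using Subgroup.closure_induction with
        | mem s hs =>
          intro l'
          have h := hV l' ⟨s, hSV ⟨s, hs, rfl⟩⟩
          rwa [show pt l' ⟨s, hSV ⟨s, hs, rfl⟩⟩ = pt (l' * s) ⟨1, h1⟩ from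
            hf (by simp [hpt])] at h
        | one => exact fun l' => by simpa using EqvGen.refl _
        | mul x y _ _ hx hy => exact fun l' => C_trans (hx l') (mul_assoc l' x y ▸ hy (l' * x))
        | inv x _ hx =>
          exact fun l' => C_symm (by simpa using hx (l' * x⁻¹))
      have hall : ∀ a, C (pt 1 ⟨1, h1⟩) a := by
        intro a
        obtain ⟨v, hv, hva⟩ := a.2.2
        have h : (f a) * v⁻¹ ∈ L := by
          have h2 : q v = q (f a) := by rw [hva, hq]
          exact QuotientGroup.rightRel_apply.1 (Quotient.exact h2)
        have h3 : pt ⟨_, h⟩ ⟨v, hv⟩ = a := hf (by simp [hpt])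
        rw [← h3]
        exact C_trans (by simpa using hL ⟨_, h⟩ 1) (hV _ _)
      exact fun a b => C_trans (C_symm (hall a)) (hall b)
  obtain ⟨i, x, hx⟩ := hL.exists_fixed_class _ rfl hR
  refine ⟨i, f x, fun l hl => ?_⟩
  have h := hx ⟨l, hl⟩⁻¹
  change QuotientGroup.leftRel (B i) _ _ at h
  rw [QuotientGroup.leftRel_apply, hf_smul] at h
  simpa [mul_assoc] using inv_mem h

/-- The retraction onto `B i` sends the generating subgroups into `A i`. -/
theorem IsInternalFreeProduct.eq_of_le {H : Type*} [Group H] {ι : Type*} {B A : ι → Subgroup H}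
    (hB : IsInternalFreeProduct B) (hle : ∀ i, A i ≤ B i) (hA : ⨆ i, A i = ⊤) (i : ι) :
    A i = B i := by
  refine le_antisymm (hle i) fun b hb => ?_
  obtain ⟨r, hr, hr'⟩ := hB.exists_retraction i
  have h : ⨆ j, A j ≤ ((A i).comap (B i).subtype).comap r := by
    refine iSup_le fun j a ha => ?_
    by_cases hj : j = i
    · subst hj
      simpa [hr ⟨a, hle j ha⟩, Subgroup.mem_subgroupOf] using ha
    · simp [hr' j hj a (hle j ha)]
  have h1 : b ∈ ((A i).comap (B i).subtype).comap r := h (hA ▸ Subgroup.mem_top b)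
  simpa [hr ⟨b, hb⟩, Subgroup.mem_subgroupOf] using h1

/-! ### Labelled tree systems and the lifting theorem -/

/-- A tree system for `G` labelled by a map to `H` that is equivariant along `φ` and sends the
classes of `R i` into cosets of `B i`. -/
structure IsLabelledTreeSystem {G H : Type*} [Group G] [Group H] {J ι : Type*} (φ : G →* H)
    (B : ι → Subgroup H) (R : ι → Setoid (G × J)) (f : G × J → H) : Prop where
  isTreeSystem : IsTreeSystem.{w} R
  map_smul : ∀ g a, f (g * a.1, a.2) = φ g * f a
  map_rel : ∀ i a b, R i a b → (f a)⁻¹ * f b ∈ B i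

namespace IsLabelledTreeSystem

variable {G H : Type*} [Group G] [Group H] {J ι : Type*} {φ : G →* H}
  {B : ι → Subgroup H} {R : ι → Setoid (G × J)} {f : G × J → H}

/-- There is a path from `x` to `y`, up to translations by the kernel of `φ`, whose successive
steps are labelled by the letters of a given word. -/
def IsPath (R : ι → Setoid (G × J)) (f : G × J → H) (y : G × J) :
    List (Σ i, B i) → G × J → Prop
  | [], x => x.2 = y.2 ∧ f x = f y
  | s :: l, x => ∃ x', R s.1 x x' ∧ f x' = f x * s.2 ∧ IsPath R f y l x'

/-- Points of one orbit with equal labels differ by an element of the kernel of `φ`, which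
translates the path without changing labels. -/
theorem IsPath.congr (h : IsLabelledTreeSystem.{w} φ B R f) {y : G × J} {l : List (Σ i, B i)}
    {x x' : G × J} (hl : IsPath R f y l x) (h2 : x'.2 = x.2) (hf : f x' = f x) :
    IsPath R f y l x' := by
  induction l generalizing x x' with
  | nil => exact ⟨h2.trans hl.1, hf.trans hl.2⟩
  | cons s l ih =>
    obtain ⟨z, hz, hfz, hl⟩ := hl
    have hx' : x' = (x'.1 * x.1⁻¹ * x.1, x.2) := by simp [← h2]
    have hφ : φ (x'.1 * x.1⁻¹) = 1 := by
      have := h.map_smul (x'.1 * x.1⁻¹) x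
      rw [← hx', hf] at this
      simpa using this.symm
    have hfz' : f (x'.1 * x.1⁻¹ * z.1, z.2) = f z := by rw [h.map_smul, hφ, one_mul]
    refine ⟨(x'.1 * x.1⁻¹ * z.1, z.2), ?_, ?_, ih hl rfl hfz'⟩
    · have := h.isTreeSystem.smul s.1 (x'.1 * x.1⁻¹) x z hz
      rwa [← hx'] at this
    · rw [hfz', hfz, hf]

theorem IsPath.prod_eq {G : Type*} {R : ι → Setoid (G × J)} {f : G × J → H} {y : G × J}
    {l : List (Σ i, B i)} {x : G × J}
    (hl : IsPath R f y l x) : f y = f x * (l.map fun s => (s.2 : H)).prod := by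
  induction l generalizing x with
  | nil => simp [hl.2]
  | cons s l ih =>
    obtain ⟨z, hz, hfz, hl⟩ := hl
    rw [ih hl, hfz]
    simp [mul_assoc]

/-- Without ties, a step with trivial label stays within a kernel translate and can be dropped;
consecutive steps of the same index are composed. -/
theorem exists_reduced_path (h : IsLabelledTreeSystem.{w} φ B R f)
    (htie : ∀ i a b, R i a b → f a = f b → a.2 = b.2) (x y : G × J) :
    ∃ w : Monoid.CoprodI.Word (fun i => B i), IsPath R f y w.toList x := by
  have hconn := h.isTreeSystem.connected x y
  have : Std.Symm (fun a b => ∃ i, R i a b) := ⟨fun a b ⟨i, h⟩ => ⟨i, Setoid.symm' _ h⟩⟩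
  rw [EqvGen.eqvGen_eq_reflTransGen] at hconn
  -- Prepends an `i`-step to a reduced path that does not begin with index `i`.
  have step : ∀ i x x' (l : List (Σ i, B i)), R i x x' → IsPath R f y l x' →
      (∀ s ∈ l, s.2 ≠ 1) → (l.IsChain fun s s' => s.1 ≠ s'.1) → (∀ s ∈ l.head?, s.1 ≠ i) →
      ∃ w : Monoid.CoprodI.Word (fun i => B i), IsPath R f y w.toList x := by
    intro i x x' l hR hl hne hchain hhead
    by_cases hf : f x = f x'
    · exact ⟨⟨l, hne, hchain⟩, hl.congr h (htie i x x' hR hf) hf⟩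
    · refine ⟨⟨⟨i, ⟨_, h.map_rel i x x' hR⟩⟩ :: l, ?_, ?_⟩, ⟨x', hR, by simp, hl⟩⟩
      · rintro s hs
        rcases List.mem_cons.1 hs with rfl | hs
        · intro h1
          have h2 := congrArg Subtype.val h1
          exact hf (by simpa [inv_mul_eq_one] using h2)
        · exact hne s hs
      · rw [List.isChain_cons]
        exact ⟨fun s hs => (hhead s hs).symm, hchain⟩
  induction hconn using ReflTransGen.head_induction_on with
  | refl => exact ⟨Monoid.CoprodI.Word.empty, rfl, rfl⟩
  | head hR hxy ih =>
    rename_i x x'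
    obtain ⟨i, hR⟩ := hR
    obtain ⟨⟨l, hne, hchain⟩, hl⟩ := ih
    match l, hne, hchain, hl with
    | [], hne, hchain, hl => exact step i x x' [] hR hl hne hchain (by simp)
    | ⟨j, b⟩ :: l, hne, hchain, hl =>
      by_cases hj : j = i
      · subst hj
        obtain ⟨z, hz, hfz, hl⟩ := hl
        rw [List.isChain_cons] at hchain
        exact step j x z l (Setoid.trans' _ hR hz) hl
          (fun s hs => hne s (List.mem_cons_of_mem _ hs)) hchain.2
          fun s hs => (hchain.1 s hs).symm
      · exact step i x x' _ hR hl hne hchain (by simpa using hj)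

/-- Otherwise a reduced path from `x` to `y` would spell a reduced word with product `1`, hence the
empty word, putting `x` and `y` in one orbit. -/
theorem exists_tie (h : IsLabelledTreeSystem.{w} φ B R f) (hB : IsInternalFreeProduct B)
    {x y : G × J} (hxy : x.2 ≠ y.2) (hf : f x = f y) :
    ∃ i a b, R i a b ∧ f a = f b ∧ a.2 ≠ b.2 := by
  classical
  by_contra! htie
  obtain ⟨w, hw⟩ := h.exists_reduced_path htie x y
  have h1 : (w.toList.map fun s => (s.2 : H)).prod = 1 := by
    have := hw.prod_eq
    rw [hf] at this
    simpa using this.symm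
  have h2 : Monoid.CoprodI.lift (fun i => (B i).subtype) w.prod = 1 := by
    rw [← h1, Monoid.CoprodI.Word.prod, map_list_prod, List.map_map]
    congr 2
  have h3 : w.prod = 1 := hB.injective (h2.trans (map_one _).symm)
  have h4 : w = Monoid.CoprodI.Word.empty := by
    apply Monoid.CoprodI.Word.equiv.symm.injective
    change w.prod = Monoid.CoprodI.Word.empty.prod
    rw [h3, Monoid.CoprodI.Word.prod_empty]
  rw [h4] at hw
  exact hxy hw.1

theorem merge (h : IsLabelledTreeSystem.{w} φ B R f) {j₁ : J} {t : G} {j₀ : {j // j ≠ j₁}} {μ : ι}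
    (ht : R μ (1, j₁) (t, j₀)) (hf : f (1, j₁) = f (t, j₀)) :
    IsLabelledTreeSystem.{w} φ B (IsTreeSystem.imageRel (IsTreeSystem.mergeMap j₁ t j₀) R)
      fun a => f (a.1, a.2) := by
  refine ⟨h.isTreeSystem.merge ht, fun g a => h.map_smul g (a.1, a.2), fun i a b hab => ?_⟩
  have hρ : ∀ a, f ((IsTreeSystem.mergeMap j₁ t j₀ a).1, (IsTreeSystem.mergeMap j₁ t j₀ a).2)
      = f a := by
    rintro ⟨g, j⟩
    by_cases hj : j = j₁
    · subst hj
      rw [IsTreeSystem.mergeMap_self]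
      have h1 := h.map_smul g (t, j₀)
      have h2 := h.map_smul g (1, j)
      rw [hf, ← h1] at h2
      simpa using h2.symm
    · simp [IsTreeSystem.mergeMap, hj]
  induction hab with
  | rel a b hab =>
    obtain ⟨a, b, rfl, rfl, hab⟩ := hab
    simpa only [hρ] using h.map_rel i a b hab
  | refl a => simp
  | symm a b _ ih => simpa using inv_mem ih
  | trans a b d _ _ h h' => simpa [mul_assoc] using mul_mem h h'

/-- Induction on the number of orbits: contracting a tie preserves the labelling. For one orbit the
stabilizers map into the `B i` and their images generate `H`. -/
theorem exists_freeProduct {G : Type u} [Group G] {ι : Type} {φ : G →* H}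
    {B : ι → Subgroup H} (hB : IsInternalFreeProduct B) (hφ : Function.Surjective φ) (n : ℕ) :
    ∀ {J : Type v} [Finite J] [Nonempty J], Nat.card J = n → ∀ {R : ι → Setoid (G × J)}
      {f : G × J → H}, IsLabelledTreeSystem.{u} φ B R f →
      ∃ A : ι → Subgroup G, IsInternalFreeProduct A ∧ ∀ i, (A i).map φ = B i := by
  induction n with
  | zero =>
    intro J _ _ hJ
    exact absurd hJ Nat.card_pos.ne'
  | succ n ih =>
    intro J _ _ hJ R f h
    have hf1 : ∀ j b, ∃ g, f (g, j) = b := by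
      intro j b
      obtain ⟨g, hg⟩ := hφ (b * (f (1, j))⁻¹)
      refine ⟨g, ?_⟩
      have := h.map_smul g (1, j)
      rw [hg] at this
      simpa using this
    rcases subsingleton_or_nontrivial J with hJ' | hJ'
    · obtain ⟨j⟩ := ‹Nonempty J›
      -- A base point labelled `1` makes the stabilizers map into `B i` itself rather than a
      -- conjugate.
      obtain ⟨g, hg⟩ := hf1 j 1
      have hA := h.isTreeSystem.isInternalFreeProduct (g, j)
      refine ⟨_, hA, hB.eq_of_le (fun i => ?_) ?_⟩
      · rintro _ ⟨s, hs, rfl⟩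
        have h1 := h.map_rel i _ _ hs
        rw [h.map_smul s (g, j), hg] at h1
        simpa using h1
      · rw [← Subgroup.map_iSup, hA.iSup_eq_top, Subgroup.map_top_of_surjective φ hφ]
    · obtain ⟨j, j', hj⟩ := exists_pair_ne J
      obtain ⟨g, hg⟩ := hf1 j 1
      obtain ⟨g', hg'⟩ := hf1 j' 1
      obtain ⟨μ, ⟨a, j₁⟩, ⟨b, j₂⟩, hab, hfab, hne⟩ :=
        h.exists_tie hB (x := (g, j)) (y := (g', j')) hj (hg.trans hg'.symm)
      let j₀ : {j // j ≠ j₁} := ⟨j₂, Ne.symm hne⟩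
      have ht : R μ (1, j₁) (a⁻¹ * b, j₀) := by
        simpa using h.isTreeSystem.smul μ a⁻¹ _ _ hab
      have hft : f (1, j₁) = f (a⁻¹ * b, j₀) := by
        have h1 := h.map_smul a⁻¹ (a, j₁)
        have h2 := h.map_smul a⁻¹ (b, j₂)
        rw [← hfab, ← h1] at h2
        simpa using h2.symm
      have : Nonempty {j // j ≠ j₁} := ⟨j₀⟩
      refine ih (J := {j // j ≠ j₁}) ?_ (h.merge ht hft)
      have := Set.ncard_sdiff_singleton_of_mem (Set.mem_univ j₁)
      rw [Set.ncard_univ, hJ] at this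
      rw [← Nat.card_coe_set_eq] at this
      rw [← Nat.add_sub_cancel (n := n) (m := 1), ← this]
      exact Nat.card_congr (Equiv.subtypeEquivRight (by simp))

end IsLabelledTreeSystem

/-- The initial labelled tree system attached to a free product decomposition of `G`. The
generating sets `S k` of the factors map into `a k * B (i k) * (b k)⁻¹`. -/
theorem exists_isLabelledTreeSystem {G : Type u} {H : Type v} [Group G] [Group H] {κ ι : Type}
    [Finite κ] {C : κ → Subgroup G} (hC : IsInternalFreeProduct C) {B : ι → Subgroup H}
    (hB : IsInternalFreeProduct B) {φ : G →* H} {S : κ → Set G} {a b : κ → H} {j : κ → ι}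
    (hS : ∀ k, Subgroup.closure (S k) = C k)
    (hφ : ∀ k, ∀ s ∈ S k, (a k)⁻¹ * φ s * b k ∈ B (j k))
    (hfree : ∀ k, (S k = C k ∧ a k = b k) ∨ ∃ t : C k, S k = {(t : G)} ∧
      ∀ (M : Type u) [Group M] (m : M), ∃ θ : C k →* M, θ t = m) :
    ∃ V : Set H, V.Finite ∧ V.Nonempty ∧ ∃ (R : ι → Setoid (G × V)) (f : G × V → H),
      IsLabelledTreeSystem.{u} φ B R f := by
  classical
  obtain ⟨V, hV, habV, h1, hconn⟩ := exists_finite_connected hB.iSup_eq_top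
    ((Set.finite_range a).union (Set.finite_range b))
  let a' : κ → V := fun k => ⟨a k, habV (Or.inl ⟨k, rfl⟩)⟩
  let b' : κ → V := fun k => ⟨b k, habV (Or.inr ⟨k, rfl⟩)⟩
  -- One sheet `{g} × V` for each `g`, with the cosets in `H`; for `s ∈ S k`, sheets `g` and `g * s`
  -- are joined at `a k` and `b k`.
  let r : ι → G × V → G × V → Prop := fun i x y =>
    (x.1 = y.1 ∧ (x.2 : H)⁻¹ * y.2 ∈ B i) ∨
      ∃ k, ∃ s ∈ S k, j k = i ∧ y.1 = x.1 * s ∧ x.2 = a' k ∧ y.2 = b' k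
  let R : ι → Setoid (G × V) := fun i => EqvGen.setoid (r i)
  have hRV : ∀ i g (v v' : V), (v : H)⁻¹ * v' ∈ B i → R i (g, v) (g, v') :=
    fun i g v v' h => EqvGen.rel _ _ (Or.inl ⟨rfl, h⟩)
  have hRS : ∀ k g, ∀ s ∈ S k, R (j k) (g, a' k) (g * s, b' k) :=
    fun k g s hs => EqvGen.rel _ _ (Or.inr ⟨k, s, hs, rfl, rfl, rfl, rfl⟩)
  refine ⟨V, hV, ⟨1, h1⟩, R, fun x => φ x.1 * x.2, ⟨?_, ?_, ?_⟩, ?_, ?_⟩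
  · intro i g x y h
    refine eqvGen_map (s := r i) (fun x : G × V => (g * x.1, x.2)) ?_ h
    rintro ⟨x, v⟩ ⟨y, v'⟩ (⟨hxy, h⟩ | ⟨k, s, hs, hk, hy, hv, hv'⟩)
    · exact EqvGen.rel _ _ (Or.inl ⟨congrArg (g * ·) hxy, h⟩)
    · refine EqvGen.rel _ _ (Or.inr ⟨k, s, hs, hk, ?_, hv, hv'⟩)
      simp only at hy ⊢
      rw [hy, mul_assoc]
  · let E : G × V → G × V → Prop := EqvGen fun x y => ∃ i, R i x y
    have E_symm : ∀ {x y}, E x y → E y x := fun h => EqvGen.symm _ _ h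
    have E_trans : ∀ {x y z}, E x y → E y z → E x z := fun h h' => EqvGen.trans _ _ _ h h'
    have hEV : ∀ g v, E (g, ⟨1, h1⟩) (g, v) := fun g v =>
      eqvGen_map (s := fun x y => ∃ i, R i x y) (fun v => (g, v))
        (fun v v' ⟨i, h⟩ => EqvGen.rel _ _ ⟨i, hRV i g v v' h⟩) (hconn v)
    have hEG : ∀ g g', E (g', ⟨1, h1⟩) (g' * g, ⟨1, h1⟩) := by
      intro g
      have hg : g ∈ Subgroup.closure (⋃ k, S k) := by
        rw [Subgroup.closure_iUnion]
        simp only [hS, hC.iSup_eq_top, Subgroup.mem_top]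
      induction hg using Subgroup.closure_induction with
      | mem s hs =>
        obtain ⟨k, hs⟩ := Set.mem_iUnion.1 hs
        exact fun g' => E_trans (hEV g' (a' k))
          (E_trans (EqvGen.rel _ _ ⟨j k, hRS k g' s hs⟩) (E_symm (hEV _ _)))
      | one => exact fun g' => by simpa using EqvGen.refl _
      | mul x y _ _ hx hy => exact fun g' => E_trans (hx g') (mul_assoc g' x y ▸ hy (g' * x))
      | inv x _ hx => exact fun g' => E_symm (by simpa using hx (g' * x⁻¹))
    rintro ⟨g, v⟩ ⟨g', v'⟩
    have := hEG (g⁻¹ * g') g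
    rw [mul_inv_cancel_left] at this
    exact E_trans (E_symm (hEV g v)) (E_trans this (hEV g' v'))
  · intro K _ c hc
    have hSC := (hB.hasPotentials.{u}).comap (Y := V) Subtype.val_injective
    have hp : ∀ g : G, ∃ p : V → K, ∀ (i : ι) (v v' : V), (v : H)⁻¹ * v' ∈ B i →
        p v * c i (g, v) (g, v') = p v' := by
      intro g
      have hrel : ∀ {i} {v v' : V}, ((QuotientGroup.leftRel (B i)).comap Subtype.val) v v' →
          (v : H)⁻¹ * v' ∈ B i := fun h => QuotientGroup.leftRel_apply.1 h
      obtain ⟨p, hp⟩ := hSC K (fun i v v' => c i (g, v) (g, v')) (fun i v v' v'' h h' =>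
        hc i _ _ _ (hRV i g _ _ (hrel h)) (hRV i g _ _ (hrel h')))
      exact ⟨p, fun i v v' h => hp i v v' (QuotientGroup.leftRel_apply.2 h)⟩
    choose p hp using hp
    -- `d` is the discrepancy between the sheet potentials across a joining edge. The sheets are
    -- matched by factors `P g` with increments `d`; `hfree` makes these increments extend to
    -- crossed homomorphisms on each `C k`.
    let d : κ → G → G → K := fun k s g =>
      p g (a' k) * c (j k) (g, a' k) (g * s, b' k) * (p (g * s) (b' k))⁻¹
    have hθ : ∀ k, ∃ θ : C k →* (G → K) ⋊[translateHom G K] G,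
        (∀ s, (θ s).right = s) ∧ ∀ s : C k, (s : G) ∈ S k → (θ s).left = d k s := by
      intro k
      rcases hfree k with ⟨hSk, hab⟩ | ⟨t, hSk, hext⟩
      · have hab' : b' k = a' k := Subtype.ext hab.symm
        refine ⟨MonoidHom.mk' (fun s => ⟨d k s, s⟩) fun s s' => ?_, fun _ => rfl, fun _ _ => rfl⟩
        ext g
        · have hm : ∀ s : C k, (s : G) ∈ S k := fun s => hSk ▸ s.2
          have h2 := hRS k g s (hm s)
          have h3 := hRS k (g * s) s' (hm s')
          rw [hab'] at h2 h3
          have := hc (j k) _ _ _ h2 h3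
          simp only [d, hab', Subgroup.coe_mul, SemidirectProduct.mul_left, Pi.mul_apply]
          simp only [translateHom, MonoidHom.coe_mk, OneHom.coe_mk, MulEquiv.coe_mk,
            Equiv.coe_fn_mk, ← mul_assoc, ← this]
          simp [mul_assoc]
        · rfl
      · obtain ⟨θ, hθ⟩ := hext _ (⟨d k t, t⟩ : (G → K) ⋊[translateHom G K] G)
        refine ⟨θ, ?_, ?_⟩
        · intro s
          have hs : (s : G) ∈ Subgroup.zpowers (t : G) := by
            rw [Subgroup.zpowers_eq_closure, ← hSk, hS]
            exact s.2
          obtain ⟨n, hn⟩ := hs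
          obtain rfl : t ^ n = s := Subtype.ext (by simpa using hn)
          have := map_zpow (SemidirectProduct.rightHom.comp θ) t n
          simpa [hθ] using this
        · intro s hs
          rw [hSk] at hs
          obtain rfl : s = t := Subtype.ext hs
          rw [hθ]
    choose θ hθ hθ' using hθ
    obtain ⟨P, hP⟩ := hC.exists_potential θ hθ
    refine ⟨fun x => P x.1 * p x.1 x.2, fun i x y h => ?_⟩
    refine hc.potential_of_eqvGen (p := fun x => P x.1 * p x.1 x.2)
      (fun x y h => EqvGen.rel _ _ h) ?_ h
    rintro ⟨x, v⟩ ⟨y, v'⟩ (⟨hxy, h⟩ | ⟨k, s, hs, hk, hy, hv, hv'⟩)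
    · obtain rfl : x = y := hxy
      simp only [mul_assoc, hp x i v v' h]
    · simp only at hy hv hv'
      subst hy hv hv' hk
      have hsC : s ∈ C k := hS k ▸ Subgroup.subset_closure hs
      have h2 := hP k ⟨s, hsC⟩ x
      rw [hθ' k ⟨s, hsC⟩ hs] at h2
      simp only [h2, d]
      group
  · intro g x
    simp [mul_assoc]
  · intro i x y h
    induction h with
    | rel x y h =>
      obtain ⟨x, v⟩ := x
      obtain ⟨y, v'⟩ := y
      rcases h with ⟨hxy, h⟩ | ⟨k, s, hs, hk, hy, hv, hv'⟩
      · obtain rfl : x = y := hxy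
        simpa [mul_assoc] using h
      · simp only at hy hv hv'
        subst hy hv hv' hk
        simpa [mul_assoc, a', b'] using hφ k s hs
    | refl x => simp
    | symm x y _ ih => simpa using inv_mem ih
    | trans x y z _ _ h h' => simpa [mul_assoc] using mul_mem h h'

/-- Higgins' form of Grushko's theorem: a surjection to a free product, such that each factor of
a decomposition of the source is infinite cyclic or is mapped into a conjugate of a factor of the
target, lifts the decomposition of the target. -/
theorem IsInternalFreeProduct.exists_lift {G : Type u} {H : Type v} [Group G] [Group H]
    {κ ι : Type} [Finite κ] [Nonempty ι] {C : κ → Subgroup G} (hC : IsInternalFreeProduct C)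
    {B : ι → Subgroup H} (hB : IsInternalFreeProduct B) {φ : G →* H}
    (hφ : Function.Surjective φ)
    (h : ∀ k, (∃ i, ∃ h : H, ∀ s ∈ C k, h⁻¹ * φ s * h ∈ B i) ∨
      Nonempty (C k ≃* Multiplicative ℤ)) :
    ∃ A : ι → Subgroup G, IsInternalFreeProduct A ∧ ∀ i, (A i).map φ = B i := by
  have h' : ∀ k, ∃ (S : Set G) (a b : H) (j : ι), Subgroup.closure S = C k ∧
      (∀ s ∈ S, a⁻¹ * φ s * b ∈ B j) ∧ ((S = C k ∧ a = b) ∨ ∃ t : C k, S = {(t : G)} ∧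
      ∀ (M : Type u) [Group M] (m : M), ∃ θ : C k →* M, θ t = m) := by
    intro k
    rcases h k with ⟨i, b, hb⟩ | ⟨⟨e⟩⟩
    · exact ⟨C k, b, b, i, Subgroup.closure_eq _, hb, Or.inl ⟨rfl, rfl⟩⟩
    · let t := e.symm (Multiplicative.ofAdd 1)
      -- With `a = φ t` and `b = 1` the condition at the generator reads `1 ∈ B j`, so any index
      -- works.
      refine ⟨{(t : G)}, φ t, 1, Classical.arbitrary ι, ?_, ?_, Or.inr ⟨t, rfl, fun M _ m => ?_⟩⟩
      · rw [← Subgroup.zpowers_eq_closure]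
        ext x
        constructor
        · rintro ⟨n, rfl⟩
          exact zpow_mem t.2 n
        · intro hx
          refine ⟨(e ⟨x, hx⟩).toAdd, ?_⟩
          have h1 : t ^ (e ⟨x, hx⟩).toAdd = ⟨x, hx⟩ := by
            rw [← map_zpow, MulEquiv.symm_apply_eq, ← ofAdd_zsmul]
            simp
          simpa using congrArg Subtype.val h1
      · rintro s rfl
        simp
      · exact ⟨(zpowersHom M m).comp e.toMonoidHom, by simp [t]⟩
  choose S a b j hS hab hfree using h'
  obtain ⟨V, hV, ⟨v, hv⟩, R, f, hR⟩ := exists_isLabelledTreeSystem hC hB hS hab hfree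
  have : Finite V := hV
  have : Nonempty V := ⟨⟨v, hv⟩⟩
  exact IsLabelledTreeSystem.exists_freeProduct hB hφ _ rfl hR

/-! ### Bounding the number of free factors -/

theorem FreeGroup.isInternalFreeProduct_zpowers (α : Type) :
    IsInternalFreeProduct fun a : α => Subgroup.zpowers (FreeGroup.of a) := by
  refine isInternalFreeProduct_of_exists_hom ?_ fun K _ f => ?_
  · rw [eq_top_iff, ← FreeGroup.closure_range_of, Subgroup.closure_le]
    rintro _ ⟨a, rfl⟩
    exact Subgroup.mem_iSup_of_mem a (Subgroup.mem_zpowers _)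
  · refine ⟨FreeGroup.lift fun a => f a ⟨_, Subgroup.mem_zpowers _⟩, fun a => ?_⟩
    rintro ⟨_, n, rfl⟩
    have h : (⟨FreeGroup.of a ^ n, n, rfl⟩ : Subgroup.zpowers (FreeGroup.of a)) =
        ⟨FreeGroup.of a, Subgroup.mem_zpowers _⟩ ^ n := by
      ext
      simp
    refine (map_zpow _ (FreeGroup.of a) n).trans ?_
    rw [FreeGroup.lift_apply_of, ← map_zpow]
    exact congrArg (f a) h.symm

theorem FreeGroup.nonempty_zpowers_mulEquiv {α : Type*} (a : α) :
    Nonempty (Subgroup.zpowers (FreeGroup.of a) ≃* Multiplicative ℤ) := by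
  obtain ⟨e⟩ := nonempty_mulEquiv_zpowers (t := FreeGroup.of a) (fun m n hmn => by
    have := congrArg (fun x =>
      (FreeGroup.lift (fun _ : α => Multiplicative.ofAdd (1 : ℤ)) x).toAdd) hmn
    simpa using this)
  exact ⟨e.symm⟩

theorem IsFreeGroup.exists_hom_ne_one (G : Type*) [Group G] [IsFreeGroup G] [Nontrivial G] :
    ∃ F : G →* Multiplicative (ZMod 2), ∃ g, F g ≠ 1 := by
  rcases isEmpty_or_nonempty (IsFreeGroup.Generators G) with h | ⟨⟨x⟩⟩
  · exact absurd (IsFreeGroup.toFreeGroup G).toEquiv.subsingleton (not_subsingleton G)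
  · exact ⟨IsFreeGroup.lift fun _ => Multiplicative.ofAdd 1, IsFreeGroup.of x, by
      rw [IsFreeGroup.lift_of]
      decide⟩

/-- A free product of `k` nontrivial groups cannot be generated by fewer than `k` elements. -/
theorem IsInternalFreeProduct.card_le {G : Type u} [Group G] {ι : Type} [Finite ι]
    {B : ι → Subgroup G} (hB : IsInternalFreeProduct B) (hne : ∀ i, B i ≠ ⊥) {α : Type} [Finite α]
    {φ : FreeGroup α →* G} (hφ : Function.Surjective φ) : Nat.card ι ≤ Nat.card α := by
  classical
  rcases isEmpty_or_nonempty ι with hι | hι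
  · simp
  obtain ⟨A, hA, hAB⟩ := (FreeGroup.isInternalFreeProduct_zpowers α).exists_lift hB hφ
    fun a => Or.inr (FreeGroup.nonempty_zpowers_mulEquiv a)
  have hf : ∀ i, ∃ F : A i →* Multiplicative (ZMod 2), ∃ g, F g ≠ 1 := fun i => by
    have : Nontrivial (A i) := by
      rw [Subgroup.nontrivial_iff_ne_bot]
      intro h
      apply hne i
      rw [← hAB, h, Subgroup.map_bot]
    exact IsFreeGroup.exists_hom_ne_one _
  choose f a hfa using hf
  -- The lifted factors are nontrivial subgroups of a free group, hence free with nontrivial maps to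
  -- `ZMod 2`. Switching these on or off gives `2 ^ |ι|` homomorphisms, against `2 ^ |α|` in all.
  have hF : ∀ ε : ι → Bool, ∃ F : FreeGroup α →* Multiplicative (ZMod 2),
      ∀ i (x : A i), F x = (if ε i then f i else 1) x := fun ε => hA.exists_hom _
  choose F hF using hF
  have hinj : Function.Injective fun ε => FreeGroup.lift.symm (F ε) := by
    intro ε ε' h
    have h' : F ε = F ε' := FreeGroup.lift.symm.injective h
    funext i
    have h1 := hF ε i (a i)
    rw [h', hF ε' i (a i)] at h1
    cases h2 : ε i <;> cases h3 : ε' i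
    · rfl
    · exact absurd (by simpa [h2, h3] using h1) (hfa i)
    · exact absurd (by simpa [h2, h3] using h1.symm) (hfa i)
    · rfl
  have h := Nat.card_le_card_of_injective _ hinj
  rw [Nat.card_fun, Nat.card_fun] at h
  have h2 : Nat.card (Multiplicative (ZMod 2)) = 2 := by
    simp [Nat.card_eq_fintype_card]
  rw [h2, Nat.card_eq_fintype_card, Fintype.card_bool] at h
  exact (Nat.pow_le_pow_iff_right (by norm_num)).1 h

theorem isInternalFreeProduct_top (G : Type u) [Group G] (ι : Type) [Unique ι] :
    IsInternalFreeProduct fun _ : ι => (⊤ : Subgroup G) := by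
  refine isInternalFreeProduct_of_exists_hom (by simp) fun K _ f =>
    ⟨(f default).comp Subgroup.topEquiv.symm.toMonoidHom, fun i a => ?_⟩
  rw [Unique.eq_default i]
  rfl

theorem isInternalFreeProduct_of_isEmpty (G : Type u) [Group G] [Subsingleton G] {ι : Type}
    [IsEmpty ι] (A : ι → Subgroup G) : IsInternalFreeProduct A :=
  isInternalFreeProduct_of_exists_hom (Subsingleton.elim _ _) fun _ _ _ =>
    ⟨1, fun i => isEmptyElim i⟩

/-! ### Existence of standard decompositions -/

/-- A finite free product decomposition into indecomposable and infinite cyclic factors is a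
standard decomposition up to a reordering. -/
theorem IsInternalFreeProduct.exists_isStandardDecomposition {G : Type u} [Group G] {κ : Type}
    [Finite κ] {A : κ → Subgroup G} (hA : IsInternalFreeProduct A)
    (h : ∀ k, IsIndecomposableGroup (A k) ∨ Nonempty (A k ≃* Multiplicative ℤ)) :
    ∃ e : Fin (Nat.card {k // IsIndecomposableGroup (A k)}) ⊕
        Fin (Nat.card {k // ¬ IsIndecomposableGroup (A k)}) ≃ κ,
      IsStandardDecomposition fun i => A (e i) := by
  classical
  let e₁ := (Finite.equivFin {k // IsIndecomposableGroup (A k)}).symm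
  let e₂ := (Finite.equivFin {k // ¬ IsIndecomposableGroup (A k)}).symm
  refine ⟨(Equiv.sumCongr e₁ e₂).trans (Equiv.sumCompl _), hA.reindex _,
    fun i => (e₁ i).2, fun j => (h (e₂ j)).resolve_left (e₂ j).2⟩

theorem exists_split {G : Type u} [Group G] [Nontrivial G] (h : ¬ IsIndecomposableGroup G)
    (h' : ¬ Nonempty (G ≃* Multiplicative ℤ)) :
    ∃ A : Fin 2 → Subgroup G, IsInternalFreeProduct A ∧ ∀ i, A i ≠ ⊥ := by
  by_contra! H
  exact h ⟨‹_›, h', H⟩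

/-- A finitely generated group has a standard decomposition. -/
theorem exists_isStandardDecomposition (G : Type u) [Group G] [Group.FG G] :
    ∃ (m n : ℕ) (A : Fin m ⊕ Fin n → Subgroup G), IsStandardDecomposition A := by
  classical
  obtain ⟨α, _, φ, hφ⟩ := Group.fg_iff_exists_freeGroup_hom_surjective_finite.1 ‹Group.FG G›
  -- A decomposition with the maximal number of nontrivial factors works: a factor that splits would
  -- give a longer one.
  let S : Set ℕ := {k | ∃ A : Fin k → Subgroup G, IsInternalFreeProduct A ∧ ∀ i, A i ≠ ⊥}
  have hbdd : BddAbove S := by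
    refine ⟨Nat.card α, ?_⟩
    rintro k ⟨A, hA, hne⟩
    simpa using hA.card_le hne hφ
  have hS : S.Nonempty := by
    rcases subsingleton_or_nontrivial G with hG | hG
    · exact ⟨0, fun _ => ⊥, isInternalFreeProduct_of_isEmpty G _, fun i => i.elim0⟩
    · exact ⟨1, fun _ => ⊤, isInternalFreeProduct_top G _, fun _ => top_ne_bot⟩
  obtain ⟨A, hA, hne⟩ := Nat.sSup_mem hS hbdd
  have h : ∀ k, IsIndecomposableGroup (A k) ∨ Nonempty (A k ≃* Multiplicative ℤ) := by
    intro k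
    by_contra! hk
    have hnt : ∀ j, Nontrivial (A j) := fun j => (Subgroup.nontrivial_iff_ne_bot _).2 (hne j)
    have hsplit : ∀ j, ∃ (d : ℕ) (C : Fin d → Subgroup (A j)), IsInternalFreeProduct C ∧
        (∀ i, C i ≠ ⊥) ∧ 1 ≤ d ∧ (j = k → 2 ≤ d) := by
      intro j
      by_cases hj : j = k
      · subst hj
        obtain ⟨C, hC, hC'⟩ := exists_split hk.1 (not_nonempty_iff.2 hk.2)
        exact ⟨2, C, hC, hC', by norm_num, fun _ => le_rfl⟩
      · exact ⟨1, fun _ => ⊤, isInternalFreeProduct_top _ _, fun _ => top_ne_bot, le_rfl,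
          fun h => absurd h hj⟩
    choose d C hC hC' hd hd' using hsplit
    have hprod := hA.sigma hC
    let e := Finite.equivFin (Σ j, Fin (d j))
    have hmem : Nat.card (Σ j, Fin (d j)) ∈ S := by
      refine ⟨_, hprod.reindex e.symm, fun i h => ?_⟩
      exact hC' _ _ ((Subgroup.map_eq_bot_iff_of_injective _ (Subgroup.subtype_injective _)).1 h)
    have hle := le_csSup hbdd hmem
    rw [Nat.card_eq_fintype_card, Fintype.card_sigma] at hle
    have hlt : ∑ _j : Fin (sSup S), 1 < ∑ j, Fintype.card (Fin (d j)) :=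
      Finset.sum_lt_sum (fun j _ => by simpa using hd j) ⟨k, Finset.mem_univ _, by
        simp only [Fintype.card_fin]
        exact hd' k rfl⟩
    simp only [Finset.sum_const, Finset.card_univ, Fintype.card_fin, smul_eq_mul, mul_one] at hlt hle
    omega
  obtain ⟨e, he⟩ := hA.exists_isStandardDecomposition h
  exact ⟨_, _, _, he⟩

/-! ### Uniqueness of the numbers of factors -/

theorem IsIndecomposableGroup.not_injective {G : Type*} [Group G] (hG : IsIndecomposableGroup G)
    (ψ : G →* Multiplicative ℤ) : ¬ Function.Injective ψ := by
  intro hψ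
  have := hG.nontrivial
  have : IsCyclic G := isCyclic_of_injective ψ hψ
  have : Infinite G := by
    obtain ⟨g, hg⟩ := exists_ne (1 : G)
    refine Infinite.of_injective (fun n : ℤ => g ^ n) fun m n hmn => ?_
    have h1 : (ψ g).toAdd ≠ 0 := by
      intro h
      exact hg (hψ (h.trans (map_one ψ).symm))
    have h2 := congrArg (fun x => (ψ x).toAdd) hmn
    simpa [h1] using h2
  exact hG.not_infinite_cyclic ⟨(intCyclicMulEquiv (G := G)).symm⟩

namespace IsStandardDecomposition

variable {G : Type u} [Group G] {m n : ℕ} {A : Fin m ⊕ Fin n → Subgroup G}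

theorem ne_bot (hA : IsStandardDecomposition A) (i : Fin m ⊕ Fin n) : A i ≠ ⊥ := by
  rw [← Subgroup.nontrivial_iff_ne_bot]
  rcases i with i | j
  · exact (hA.indecomposable i).nontrivial
  · obtain ⟨e⟩ := hA.infinite_cyclic j
    exact e.toEquiv.nontrivial

theorem not_conj_mem_inr (hA : IsStandardDecomposition A) {L : Subgroup G}
    (hL : IsIndecomposableGroup L) (j : Fin n) (h : G) :
    ¬ ∀ l ∈ L, h⁻¹ * l * h ∈ A (Sum.inr j) := by
  intro H
  obtain ⟨e⟩ := hA.infinite_cyclic j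
  let c : L →* A (Sum.inr j) :=
    ((MulAut.conj h⁻¹).toMonoidHom.comp L.subtype).codRestrict _ fun l => by
      simpa using H l l.2
  refine hL.not_injective (e.toMonoidHom.comp c) (e.injective.comp fun l l' hll => ?_)
  have := congrArg Subtype.val hll
  simpa [c] using this

theorem exists_conj_mem (hA : IsStandardDecomposition A) {L : Subgroup G} [Group.FG L]
    (hL : IsIndecomposableGroup L) : ∃ i : Fin m, ∃ h : G, ∀ l ∈ L, h⁻¹ * l * h ∈ A (Sum.inl i) := by
  obtain ⟨i | j, h, H⟩ := hA.free_product.exists_conj_mem hL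
  · exact ⟨i, h, H⟩
  · exact absurd H (hA.not_conj_mem_inr hL j h)

/-- Conjugating indecomposable factors into one another gives index maps both ways; the round trip
is the identity because distinct factors are not conjugate into each other. -/
theorem le_of_isStandardDecomposition [Group.FG G] (hA : IsStandardDecomposition A) {m' n' : ℕ}
    {A' : Fin m' ⊕ Fin n' → Subgroup G} (hA' : IsStandardDecomposition A') : m ≤ m' := by
  have := fun i => hA.free_product.fg i
  have := fun i => hA'.free_product.fg i
  choose σ h hσ using fun i => hA'.exists_conj_mem (hA.indecomposable i)
  choose τ h' hτ using fun i => hA.exists_conj_mem (hA'.indecomposable i)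
  have hστ : ∀ i, τ (σ i) = i := by
    intro i
    by_contra hne
    refine hA.ne_bot (Sum.inl i) (hA.free_product.eq_bot_of_conj (j := Sum.inl (τ (σ i)))
      (g := h i * h' (σ i)) (by simpa using Ne.symm hne) fun a ha => ?_)
    simpa [mul_assoc] using hτ _ _ (hσ i a ha)
  simpa using Fintype.card_le_of_injective σ (Function.LeftInverse.injective hστ)

/-- Recovers `n` from a count that is the same for all standard decompositions, as their
indecomposable factors are conjugate into one another. -/
theorem card_hom (hA : IsStandardDecomposition A) :
    Nat.card {F : G →* Multiplicative (ZMod 2) // ∀ i, ∀ a ∈ A (Sum.inl i), F a = 1} = 2 ^ n := by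
  let e := fun j => (hA.infinite_cyclic j).some
  let t : ∀ j, A (Sum.inr j) := fun j => (e j).symm (Multiplicative.ofAdd 1)
  have ht : ∀ j (x : A (Sum.inr j)), x = t j ^ (e j x).toAdd := fun j x => by
    rw [← map_zpow, MulEquiv.eq_symm_apply, ← ofAdd_zsmul]
    simp
  have hbij : Function.Bijective fun (F : {F : G →* Multiplicative (ZMod 2) //
      ∀ i, ∀ a ∈ A (Sum.inl i), F a = 1}) (j : Fin n) => F.1 (t j) := by
    constructor
    · intro F F' h
      refine Subtype.ext (MonoidHom.eq_of_iSup_eq_top hA.free_product.iSup_eq_top ?_)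
      rintro (i | j) a ha
      · rw [F.2 i a ha, F'.2 i a ha]
      · have h1 := congrArg Subtype.val (ht j ⟨a, ha⟩)
        simp only [Subgroup.coe_zpow] at h1
        have h2 : F.1 (t j) = F'.1 (t j) := congrFun h j
        rw [h1, map_zpow, map_zpow, h2]
    · intro ε
      obtain ⟨F, hF⟩ := hA.free_product.exists_hom (K := Multiplicative (ZMod 2))
        (fun i => match i with
          | Sum.inl _ => 1
          | Sum.inr j => (zpowersHom _ (ε j)).comp (e j).toMonoidHom)
      exact ⟨⟨F, fun i a ha => hF (Sum.inl i) ⟨a, ha⟩⟩, funext fun j => by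
        simp [hF (Sum.inr j), t]⟩
  rw [Nat.card_eq_of_bijective _ hbij]
  simp [Nat.card_eq_fintype_card]

/-- The numbers of factors of the two kinds do not depend on the standard decomposition. -/
theorem eq_and_eq [Group.FG G] (hA : IsStandardDecomposition A) {m' n' : ℕ}
    {A' : Fin m' ⊕ Fin n' → Subgroup G} (hA' : IsStandardDecomposition A') :
    m = m' ∧ n = n' := by
  refine ⟨le_antisymm (hA.le_of_isStandardDecomposition hA')
    (hA'.le_of_isStandardDecomposition hA), ?_⟩
  have key : ∀ {m n m' n' : ℕ} {A : Fin m ⊕ Fin n → Subgroup G}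
      {A' : Fin m' ⊕ Fin n' → Subgroup G}, IsStandardDecomposition A →
      IsStandardDecomposition A' → ∀ F : G →* Multiplicative (ZMod 2),
      (∀ i, ∀ a ∈ A (Sum.inl i), F a = 1) → ∀ i, ∀ a ∈ A' (Sum.inl i), F a = 1 := by
    intro m n m' n' A A' hA hA' F hF i a ha
    have := hA'.free_product.fg (Sum.inl i)
    obtain ⟨i', h, H⟩ := hA.exists_conj_mem (hA'.indecomposable i)
    have := hF i' _ (H a ha)
    simpa [mul_comm] using this
  have h := Nat.card_congr (Equiv.subtypeEquivRight
    fun F : G →* Multiplicative (ZMod 2) => ⟨key hA hA' F, key hA' hA F⟩)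
  rw [hA.card_hom, hA'.card_hom] at h
  exact Nat.pow_right_injective le_rfl h

theorem scottComplexity_eq [Group.FG G] (hA : IsStandardDecomposition A) :
    scottComplexity G = toLex (m + n, n) := by
  have h : ∃ c, HasScottComplexity G c := ⟨_, m, n, A, hA, rfl⟩
  rw [scottComplexity, dif_pos h]
  obtain ⟨m', n', A', hA', hc⟩ := h.choose_spec
  obtain ⟨rfl, rfl⟩ := hA.eq_and_eq hA'
  exact hc

end IsStandardDecomposition

/-! ### Comparison of complexities -/

namespace IsStandardDecomposition

theorem indecomposable_or_infinite_cyclic {G : Type u} [Group G] {m n : ℕ}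
    {A : Fin m ⊕ Fin n → Subgroup G} (hA : IsStandardDecomposition A) (i : Fin m ⊕ Fin n) :
    IsIndecomposableGroup (A i) ∨ Nonempty (A i ≃* Multiplicative ℤ) := by
  rcases i with i | j
  · exact Or.inl (hA.indecomposable i)
  · exact Or.inr (hA.infinite_cyclic j)

theorem of_add_eq_one {G : Type u} [Group G] {m n : ℕ} {A : Fin m ⊕ Fin n → Subgroup G}
    (hA : IsStandardDecomposition A) (h : m + n = 1) :
    IsIndecomposableGroup G ∨ Nonempty (G ≃* Multiplicative ℤ) := by
  have hcard : Fintype.card (Fin m ⊕ Fin n) = 1 := by simpa using h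
  obtain ⟨i, hi⟩ := Fintype.card_eq_one_iff.1 hcard
  have htop : A i = ⊤ := by
    rw [← hA.free_product.iSup_eq_top]
    exact le_antisymm (le_iSup A i) (iSup_le fun j => by rw [hi j])
  let e : A i ≃* G := (MulEquiv.subgroupCongr htop).trans Subgroup.topEquiv
  rcases hA.indecomposable_or_infinite_cyclic i with h | ⟨⟨e'⟩⟩
  · exact Or.inl (h.of_mulEquiv e)
  · exact Or.inr ⟨e.symm.trans e'⟩

theorem add_pos {G : Type u} [Group G] [Nontrivial G] {m n : ℕ} {A : Fin m ⊕ Fin n → Subgroup G}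
    (hA : IsStandardDecomposition A) : 1 ≤ m + n := by
  by_contra! h
  have : IsEmpty (Fin m ⊕ Fin n) := by
    rw [← Fintype.card_eq_zero_iff]
    simpa using h
  have := hA.free_product.iSup_eq_top
  rw [iSup_of_empty] at this
  exact bot_ne_top this

theorem isIndecomposableFactor_of_isIndecomposableGroup {G : Type u} [Group G] {m n : ℕ}
    {A : Fin m ⊕ Fin n → Subgroup G} (hA : IsStandardDecomposition A) {i : Fin m ⊕ Fin n}
    (hi : IsIndecomposableGroup (A i)) : IsIndecomposableFactor (A i) := by
  rcases i with i | j
  · exact ⟨m, n, A, i, hA, rfl⟩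
  · exact absurd (hA.infinite_cyclic j) hi.not_infinite_cyclic

/-- A finite free product decomposition of `G` has at most as many nontrivial factors as a standard
decomposition; in case of equality each factor is indecomposable or infinite cyclic. -/
theorem card_le_of_isInternalFreeProduct {G : Type u} [Group G] [Group.FG G] {m n : ℕ}
    {D : Fin m ⊕ Fin n → Subgroup G} (hD : IsStandardDecomposition D) {ι : Type} [Fintype ι]
    {A : ι → Subgroup G} (hA : IsInternalFreeProduct A) (hne : ∀ i, A i ≠ ⊥) :
    Fintype.card ι ≤ m + n ∧ (Fintype.card ι = m + n →
      ∀ i, IsIndecomposableGroup (A i) ∨ Nonempty (A i ≃* Multiplicative ℤ)) := by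
  classical
  have hnt : ∀ i, Nontrivial (A i) := fun i => (Subgroup.nontrivial_iff_ne_bot _).2 (hne i)
  have := fun i => hA.fg i
  choose p q C hC using fun i => exists_isStandardDecomposition (A i)
  have hprod := hA.sigma fun i => (hC i).free_product
  obtain ⟨e, he⟩ := hprod.exists_isStandardDecomposition (by
    rintro ⟨i, k⟩
    let e := (C i k).equivMapOfInjective (A i).subtype (A i).subtype_injective
    rcases (hC i).indecomposable_or_infinite_cyclic k with h | ⟨⟨e'⟩⟩
    · exact Or.inl (h.of_mulEquiv e)
    · exact Or.inr ⟨e.symm.trans e'⟩)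
  -- Refining every `A i` gives a standard decomposition of `G`, whose size is known by uniqueness.
  have hsum : ∑ i, (p i + q i) = m + n := by
    obtain ⟨h1, h2⟩ := he.eq_and_eq hD
    have := Fintype.card_congr e
    rw [Fintype.card_sum, Fintype.card_fin, Fintype.card_fin, h1, h2, Fintype.card_sigma] at this
    simpa using this.symm
  have hpos : ∀ i ∈ Finset.univ, 1 ≤ p i + q i := fun i _ => (hC i).add_pos
  have hcard : Fintype.card ι = ∑ _i : ι, 1 := by simp
  rw [← hsum, hcard]
  exact ⟨Finset.sum_le_sum hpos, fun h i => (hC i).of_add_eq_one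
    ((Finset.sum_eq_sum_iff_of_le hpos).1 h i (Finset.mem_univ i)).symm⟩

theorem lift_of_surjective {G : Type u} {H : Type v} [Group G] [Group H] [Group.FG G] [Group.FG H]
    {φ : G →* H} (hφ : Function.Surjective φ) {p q m n : ℕ} {D : Fin p ⊕ Fin q → Subgroup G}
    (hD : IsStandardDecomposition D) {B : Fin m ⊕ Fin n → Subgroup H}
    (hB : IsStandardDecomposition B)
    (hfactor : ∀ K : Subgroup G, IsIndecomposableFactor K →
      ∃ i : Fin m, ∃ h : H, ∀ s ∈ K, h⁻¹ * φ s * h ∈ B (Sum.inl i)) :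
    toLex (m + n, n) ≤ toLex (p + q, q) ∧ (p = m → q = n →
      ∃ A : Fin m ⊕ Fin n → Subgroup G, IsStandardDecomposition A ∧ ∀ i, (A i).map φ = B i) := by
  classical
  rcases isEmpty_or_nonempty (Fin m ⊕ Fin n) with hempty | hne
  · have h : m + n = 0 := by
      rw [← Fintype.card_eq_zero_iff] at hempty
      simpa using hempty
    obtain ⟨rfl, rfl⟩ : m = 0 ∧ n = 0 := by omega
    refine ⟨?_, ?_⟩
    · rw [Prod.Lex.toLex_le_toLex]
      simp only
      omega
    · rintro rfl rfl
      exact ⟨D, hD, fun i => isEmptyElim i⟩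
  obtain ⟨A, hA, hAB⟩ := hD.free_product.exists_lift hB.free_product hφ (by
    rintro (i | j)
    · obtain ⟨i', h⟩ := hfactor _ ⟨p, q, D, i, hD, rfl⟩
      exact Or.inl ⟨Sum.inl i', h⟩
    · exact Or.inr (hD.infinite_cyclic j))
  have hAne : ∀ i, A i ≠ ⊥ := fun i h => hB.ne_bot i (by rw [← hAB, h, Subgroup.map_bot])
  obtain ⟨hle, heq⟩ := hD.card_le_of_isInternalFreeProduct hA hAne
  simp only [Fintype.card_sum, Fintype.card_fin] at hle heq
  -- An indecomposable `A (Sum.inr j)` would be a factor of `G`, so its image `B (Sum.inr j)` would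
  -- be conjugate into some `B (Sum.inl i)`. The hypothesis is needed here for a factor outside `D`.
  have key : m + n = p + q → (∀ j, ¬ IsIndecomposableGroup (A (Sum.inr j))) ∧
      Nat.card {k // ¬ IsIndecomposableGroup (A k)} = q := by
    intro h
    obtain ⟨e, he⟩ := hA.exists_isStandardDecomposition (heq h)
    refine ⟨fun j hj => ?_, (he.eq_and_eq hD).2⟩
    have hfac : IsIndecomposableFactor (A (Sum.inr j)) := by
      have := he.isIndecomposableFactor_of_isIndecomposableGroup (i := e.symm (Sum.inr j))
        (by rwa [e.apply_symm_apply])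
      rwa [e.apply_symm_apply] at this
    obtain ⟨i, h, H⟩ := hfactor _ hfac
    refine hB.ne_bot (Sum.inr j) (hB.free_product.eq_bot_of_conj (j := Sum.inl i) (g := h)
      (by simp) ?_)
    rw [← hAB]
    rintro _ ⟨s, hs, rfl⟩
    exact H s hs
  constructor
  · rw [Prod.Lex.toLex_le_toLex]
    rcases hle.lt_or_eq with h | h
    · exact Or.inl h
    · refine Or.inr ⟨h, ?_⟩
      obtain ⟨h1, h2⟩ := key h
      simp only
      rw [← h2]
      simpa using Nat.card_le_card_of_injective
        (fun j : Fin n => (⟨Sum.inr j, h1 j⟩ : {k // ¬ IsIndecomposableGroup (A k)}))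
        fun j j' hj => by simpa using hj
  · rintro rfl rfl
    obtain ⟨h1, h2⟩ := key rfl
    refine ⟨A, ⟨hA, fun i => ?_, fun j => (heq rfl _).resolve_left (h1 j)⟩, hAB⟩
    by_contra hi
    let f : Fin q → {k // ¬ IsIndecomposableGroup (A k)} := fun j => ⟨Sum.inr j, h1 j⟩
    have hf : Function.Injective f := fun j j' hj => by simpa [f] using hj
    -- There are exactly `q` factors that are not indecomposable, and the `Sum.inr` ones exhaust
    -- them.
    have hf' : Function.Bijective f :=
      (Fintype.bijective_iff_injective_and_card f).2 ⟨hf, by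
        rw [← Nat.card_eq_fintype_card, ← Nat.card_eq_fintype_card, h2]
        simp⟩
    obtain ⟨j, hj⟩ := hf'.surjective ⟨Sum.inl i, hi⟩
    simp [f] at hj

end IsStandardDecomposition

theorem theorem1p2 {G : Type*} {H : Type*} [Group G] [Group H] [Group.FG G] [Group.FG H]
    (φ : G →* H) (hφ : Function.Surjective φ)
    (hfactor : ∀ K : Subgroup G, IsIndecomposableFactor K →
      ∃ L : Subgroup H, IsIndecomposableFactor L ∧
        ∃ h : H, (K.map φ).map (MulAut.conj h).toMonoidHom ≤ L) :
    scottComplexity H ≤ scottComplexity G ∧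
      (scottComplexity G = scottComplexity H →
        ∀ (m n : ℕ) (B : Fin m ⊕ Fin n → Subgroup H), IsStandardDecomposition B →
          ∃ A : Fin m ⊕ Fin n → Subgroup G,
            IsStandardDecomposition A ∧ ∀ i, (A i).map φ = B i) := by
  have hfactor' : ∀ {m n : ℕ} {B : Fin m ⊕ Fin n → Subgroup H}, IsStandardDecomposition B →
      ∀ K : Subgroup G, IsIndecomposableFactor K →
        ∃ i : Fin m, ∃ h : H, ∀ s ∈ K, h⁻¹ * φ s * h ∈ B (Sum.inl i) := by
    intro m n B hB K hK
    obtain ⟨L, ⟨m', n', B', i', hB', rfl⟩, h, hKL⟩ := hfactor K hK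
    have := hB'.free_product.fg (Sum.inl i')
    obtain ⟨i, h', H'⟩ := hB.exists_conj_mem (hB'.indecomposable i')
    refine ⟨i, h⁻¹ * h', fun s hs => ?_⟩
    have h1 : h * φ s * h⁻¹ ∈ B' (Sum.inl i') := hKL ⟨φ s, ⟨s, hs, rfl⟩, rfl⟩
    simpa [mul_assoc] using H' _ h1
  obtain ⟨p, q, D, hD⟩ := exists_isStandardDecomposition G
  obtain ⟨m, n, B, hB⟩ := exists_isStandardDecomposition H
  refine ⟨?_, fun h m' n' B' hB' => ?_⟩
  · rw [hD.scottComplexity_eq, hB.scottComplexity_eq]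
    exact (hD.lift_of_surjective hφ hB (hfactor' hB)).1
  · rw [hD.scottComplexity_eq, hB'.scottComplexity_eq, toLex_inj, Prod.mk.injEq] at h
    exact (hD.lift_of_surjective hφ hB' (hfactor' hB')).2 (by omega) h.2
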